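/- **Corollary 4.8.** Let $M$ be a smooth manifold (Hausdorff, second countable, without boundary) of dimension $r+s$, let $\mathcal F$ be a smooth foliation of $M$ with $s$-dimensional leaves and tangent bundle $Y\subset TM$, and let $g$ be a smooth Riemannian metric on $M$; put $X=Y^{\perp}$. Suppose that $g$ is bundle-like with respect to $\mathcal F$: around each point of $M$ there is a smooth local $g$-orthonormal frame $e_1,\dots,e_{r+s}$ such that $e_1,\dots,e_r$ span $X$, $e_{r+1},\dots,e_{r+s}$ span $Y$, and $[e_\alpha,e_j]$ is a section of $Y$ for all $1\le j\le r<\alpha\le r+s$. (Thus $\mathcal F$ is a Riemannian foliation.) Suppose also that all leaves, with the metrics induced by $g$, have positive scalar curvature. For a constant $f>0$ let $$g_f=g_X\oplus \frac1{f^2}\,g_Y ,$$ where $g_X$ and $g_Y$ are the restrictions of $g$ to $X$ and $Y$. Then $g_f$ is a smooth Riemannian metric on $M$ for every $f>0$, and: 1. if $M$ is compact, then there is $f_0>0$ such that $g_f$ has positive scalar curvature on all of $M$ for every $f\ge f_0$; in particular $M$ admits a metric of positive scalar curvature; 2. for every compact set $K\subset M$ ($M$ compact or not) there is $f_0>0$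 such that the scalar curvature of $g_f$ is positive at every point of $K$ for every $f\ge f_0$. -/

import Mathlib

open scoped Manifold ContDiff

noncomputable section

namespace FoliatedScalarCurvature

/-! ### Scalar curvature in coordinates -/

/-- The partial derivative `∂ₖ f` on `ℝⁿ`. -/
def partialDeriv {n : ℕ} (k : Fin n) (f : EuclideanSpace ℝ (Fin n) → ℝ)
    (y : EuclideanSpace ℝ (Fin n)) : ℝ :=
  fderiv ℝ f y (EuclideanSpace.single k 1)

/-- The Christoffel symbols of the second kind
`Γᵏᵢⱼ = ½ ∑ₗ Gᵏˡ (∂ᵢ Gⱼₗ + ∂ⱼ Gᵢₗ - ∂ₗ Gᵢⱼ)`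
of a metric with coefficient matrix `G`. -/
def christoffel {n : ℕ} (G : EuclideanSpace ℝ (Fin n) → Matrix (Fin n) (Fin n) ℝ)
    (k i j : Fin n) (y : EuclideanSpace ℝ (Fin n)) : ℝ :=
  (1 / 2 : ℝ) * ∑ l, (G y)⁻¹ k l *
    (partialDeriv i (fun z => G z j l) y + partialDeriv j (fun z => G z i l) y
      - partialDeriv l (fun z => G z i j) y)

/-- The Ricci tensor
`Ricⱼₖ = ∑ᵢ (∂ᵢ Γⁱⱼₖ - ∂ⱼ Γⁱᵢₖ) + ∑ᵢₚ (Γⁱᵢₚ Γᵖⱼₖ - Γⁱⱼₚ Γᵖᵢₖ)`. -/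
def coordRicci {n : ℕ} (G : EuclideanSpace ℝ (Fin n) → Matrix (Fin n) (Fin n) ℝ)
    (j k : Fin n) (y : EuclideanSpace ℝ (Fin n)) : ℝ :=
  ∑ i, (partialDeriv i (christoffel G i j k) y - partialDeriv j (christoffel G i i k) y)
    + ∑ i, ∑ p, (christoffel G i i p y * christoffel G p j k y
        - christoffel G i j p y * christoffel G p i k y)

/-- The scalar curvature `∑ⱼₖ Gʲᵏ Ricⱼₖ` of the metric with coefficient matrix `G`. It equals
`2` on the round unit sphere of dimension two. -/
def coordScalar {n : ℕ} (G : EuclideanSpace ℝ (Fin n) → Matrix (Fin n) (Fin n) ℝ)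
    (y : EuclideanSpace ℝ (Fin n)) : ℝ :=
  ∑ j, ∑ k, (G y)⁻¹ j k * coordRicci G j k y

/-! ### Riemannian metrics on a manifold -/

/-- Smooth Riemannian metrics on the smooth `n`-dimensional manifold `M`. -/
abbrev SmoothMetric (n : ℕ) (M : Type*) [TopologicalSpace M]
    [ChartedSpace (EuclideanSpace ℝ (Fin n)) M] [IsManifold (𝓡 n) ∞ M] :=
  Bundle.ContMDiffRiemannianMetric (𝓡 n) ∞ (EuclideanSpace ℝ (Fin n))
    (fun x : M => TangentSpace (𝓡 n) x)

section Metric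

variable {n : ℕ} {M : Type*} [TopologicalSpace M]
  [ChartedSpace (EuclideanSpace ℝ (Fin n)) M] [IsManifold (𝓡 n) ∞ M]

/-- The coefficients `(ι^* g)(∂ₐ, ∂_b)` of the pullback of `g` under a map `ι` from `ℝᵐ` to `M`. -/
def pullbackGram {m : ℕ} (g : SmoothMetric n M) (ι : EuclideanSpace ℝ (Fin m) → M)
    (y : EuclideanSpace ℝ (Fin m)) : Matrix (Fin m) (Fin m) ℝ :=
  Matrix.of fun a b =>
    g.inner (ι y) (mfderiv (𝓡 m) (𝓡 n) ι y (EuclideanSpace.single a (1 : ℝ)))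
      (mfderiv (𝓡 m) (𝓡 n) ι y (EuclideanSpace.single b (1 : ℝ)))

/-- The scalar curvature of `(M, g)` at `x`, computed in the preferred chart at `x`. -/
def scalarCurvature (g : SmoothMetric n M) (x : M) : ℝ :=
  coordScalar (pullbackGram g (extChartAt (𝓡 n) x).symm) (extChartAt (𝓡 n) x x)

/-- `g` is a metric of positive scalar curvature. -/
def IsPSC (g : SmoothMetric n M) : Prop :=
  ∀ x, 0 < scalarCurvature g x

/-- `v` lies in the `g`-orthogonal complement of the subspace `Y` of `TₓM`. -/
def IsOrthogonalTo (g : SmoothMetric n M) {x : M}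
    (v : TangentSpace (𝓡 n) x) (Y : Submodule ℝ (TangentSpace (𝓡 n) x)) : Prop :=
  ∀ u ∈ Y, g.inner x v u = 0

end Metric

/-! ### Foliations -/

/-- A smooth foliation of the `(r + s)`-dimensional manifold `M` by leaves of dimension `s`, given
by its tangent bundle `Y`: around each point there is a smooth chart of `M` in which `Y` is spanned
by the last `s` coordinate directions, so that the plaques are the slices on which the first `r`
coordinates are constant. -/
structure Foliation (r s : ℕ) (M : Type*) [TopologicalSpace M]
    [ChartedSpace (EuclideanSpace ℝ (Fin (r + s))) M] where
  /-- the tangent spaces of the leaves -/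
  tangent (x : M) : Submodule ℝ (TangentSpace (𝓡 (r + s)) x)
  exists_foliated_chart (x : M) : ∃ φ ∈ IsManifold.maximalAtlas (𝓡 (r + s)) ∞ M, x ∈ φ.source ∧
    ∀ p ∈ φ.source, ∀ v : TangentSpace (𝓡 (r + s)) p,
      v ∈ tangent p ↔ ∀ i : Fin r,
        (EuclideanSpace.proj (Fin.castAdd s i) : EuclideanSpace ℝ (Fin (r + s)) →L[ℝ] ℝ)
          (mfderiv (𝓡 (r + s)) (𝓡 (r + s)) φ p v) = 0

section Foliation

variable {r s : ℕ} {M : Type*} [TopologicalSpace M]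
  [ChartedSpace (EuclideanSpace ℝ (Fin (r + s))) M]

/-- `ι : V → M`, with `V ⊆ ℝˢ` open, is a local parametrization of leaves: a smooth map whose
differential maps `ℝˢ` onto the tangent space of the leaf at each point (it is then injective, by
dimension). On a connected `V`, such maps are local parametrizations (inverse charts, near
each point) of the immersed leaf through any of their values. -/
structure IsLeafParametrization (F : Foliation r s M) (V : Set (EuclideanSpace ℝ (Fin s)))
    (ι : EuclideanSpace ℝ (Fin s) → M) : Prop where
  isOpen : IsOpen V
  contMDiffOn : ContMDiffOn (𝓡 s) (𝓡 (r + s)) ∞ ι V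
  range_mfderiv : ∀ y ∈ V,
    LinearMap.range (mfderiv (𝓡 s) (𝓡 (r + s)) ι y).toLinearMap = F.tangent (ι y)

variable [IsManifold (𝓡 (r + s)) ∞ M]

/-- With the metrics induced by `g`, all leaves of `F` have positive scalar curvature at every
point (the scalar curvature of a leaf being computed in any coordinates on the leaf). -/
def HasPSCLeaves (g : SmoothMetric (r + s) M) (F : Foliation r s M) : Prop :=
  ∀ (V : Set (EuclideanSpace ℝ (Fin s))) (ι : EuclideanSpace ℝ (Fin s) → M),
    IsLeafParametrization F V ι → ∀ y ∈ V, 0 < coordScalar (pullbackGram g ι) y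

/-- A smooth `g`-orthonormal frame `e₁, …, e_r, e_{r+1}, …, e_{r+s}` on the open set `U` whose last
`s` members span the tangent spaces of the leaves; the first `r` members then span
their orthogonal complements. -/
structure IsAdaptedFrameOn (g : SmoothMetric (r + s) M) (F : Foliation r s M) (U : Set M)
    (e : Fin (r + s) → (x : M) → TangentSpace (𝓡 (r + s)) x) : Prop where
  isOpen : IsOpen U
  contMDiffOn : ∀ i, ContMDiffOn (𝓡 (r + s)) (𝓡 (r + s)).tangent ∞
    (fun x => (⟨x, e i x⟩ : TangentBundle (𝓡 (r + s)) M)) U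
  orthonormal : ∀ x ∈ U, ∀ i j, g.inner x (e i x) (e j x) = if i = j then 1 else 0
  span_eq : ∀ x ∈ U,
    Submodule.span ℝ (Set.range fun α : Fin s => e (Fin.natAdd r α) x) = F.tangent x

/-- The metric `g` is bundle-like with respect to `F`: near each point there is an adapted
orthonormal frame such that the bracket of each leafwise member with each transverse
member is tangent to the leaves. -/
def IsBundleLike (g : SmoothMetric (r + s) M) (F : Foliation r s M) : Prop :=
  ∀ x : M, ∃ (U : Set M) (e : Fin (r + s) → (x : M) → TangentSpace (𝓡 (r + s)) x),
    x ∈ U ∧ IsAdaptedFrameOn g F U e ∧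
    ∀ p ∈ U, ∀ (α : Fin s) (j : Fin r),
      VectorField.mlieBracket (𝓡 (r + s)) (e (Fin.natAdd r α)) (e (Fin.castAdd s j)) p
        ∈ F.tangent p

/-- `g'` is the metric `g_X ⊕ (1 / f²) g_Y`, where `Y` is the tangent bundle of `F` and `X` is its
`g`-orthogonal complement. -/
def IsCollapse (g : SmoothMetric (r + s) M) (F : Foliation r s M) (f : ℝ)
    (g' : SmoothMetric (r + s) M) : Prop :=
  ∀ (x : M) (v w : TangentSpace (𝓡 (r + s)) x),
    (v ∈ F.tangent x → w ∈ F.tangent x → g'.inner x v w = (1 / f ^ 2) * g.inner x v w) ∧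
    (IsOrthogonalTo g v (F.tangent x) → IsOrthogonalTo g w (F.tangent x) →
      g'.inner x v w = g.inner x v w) ∧
    (IsOrthogonalTo g v (F.tangent x) → w ∈ F.tangent x → g'.inner x v w = 0)

end Foliation

end FoliatedScalarCurvature

end

noncomputable section

namespace FoliatedScalarCurvature

/-! ### Scalar curvature in an orthonormal frame: algebra -/

/-! Write `c_abd = g([e_a, e_b], e_d)` for the structure coefficients of an orthonormal frame, and
`H_a = ∑_b c_abb`. The scalar curvature is `∑_a (2 e_a(H_a) - H_a²) - ¼ ∑ c_abd² - ½ ∑ c_abd c_adb`.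
This depends on brackets and inner products only, so its behaviour under constant rescaling of the
frame can be read off termwise.

If `e` is an adapted frame for `g`, then `g_f` has the orthonormal frame `w_a e_a`, with `w = 1` on
transverse and `w = f` on leafwise vectors, and its structure coefficients are `(w_a w_b / w_d)
c_abd`. All terms except the pure squares group into expressions attached to a single index `a` and
scale by `w_a²`; the squares scale by `(w_a w_b / w_d)²`. The dangerous weights are `f` on
transverse components of mixed brackets and `f²` on transverse components of leafwise brackets. The
former components vanish because `g` is bundle-like, the latter because the leaf distribution is
involutive. The same vanishing shows that the order `f²` part is exactly the scalar curvature of the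
leaf. Hence `scal(g_f) ≥ f² scal_leaf + C` for `f ≥ 1`, with `C` continuous and independent of `f`
(`IsCollapse.le_scalarCurvature`). Positivity and continuity of `scal_leaf` give a threshold near
each point, and compactness makes it uniform.

The frame formula is proved for coordinate metrics in `sum_curvature_eq` and
`coordScalar_eq_of_frame`. `coordScalar_pullbackGram` transfers it to any parametrized submanifold
tangent to an orthonormal family: applied to inverse charts it computes the curvature of `M`,
applied to leaf parametrizations that of the leaves. The transfer rests on
`mfderiv_lieBracket_of_related`, which also gives involutivity. The metrics `g_f` are built in
`leafScaledMetric` as `g + (1/f² - 1) g_Y`. -/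

/-- The quadratic part of the scalar curvature in an orthonormal frame with structure
coefficients `c`. -/
def structQuadratic {ι : Type*} [Fintype ι] (c : ι → ι → ι → ℝ) : ℝ :=
  -(1 / 4) * ∑ a, ∑ b, ∑ d, c a b d ^ 2 - (1 / 2) * ∑ a, ∑ b, ∑ d, c a b d * c a d b

/-- With `γ_abd = g(∇_{e_a} e_b, e_d)`, everything reduces to `P = ∑ γ_abd²` and `Q = ∑ γ_abd γ_bad`
by renaming indices and antisymmetry. The `P` terms cancel and both sides equal `-Q`, so the Koszul
formula is not needed. -/
lemma sum_connection_eq_structQuadratic {ι : Type*} [Fintype ι] (γ c : ι → ι → ι → ℝ)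
    (hγ : ∀ a b d, γ a b d = -γ a d b) (hc : ∀ a b d, c a b d = γ a b d - γ b a d) :
    ∑ a, ∑ b, ∑ d, (γ a b d * γ b a d - c a b d * γ d b a) = structQuadratic c := by
  have s12 : ∀ f : ι → ι → ι → ℝ, ∑ a, ∑ b, ∑ d, f a b d = ∑ a, ∑ b, ∑ d, f b a d :=
    fun f => Finset.sum_comm
  have s23 : ∀ f : ι → ι → ι → ℝ, ∑ a, ∑ b, ∑ d, f a b d = ∑ a, ∑ b, ∑ d, f a d b :=
    fun f => Finset.sum_congr rfl fun a _ => Finset.sum_comm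
  have hP : ∑ a, ∑ b, ∑ d, γ b a d ^ 2 = ∑ a, ∑ b, ∑ d, γ a b d ^ 2 :=
    s12 fun a b d => γ b a d ^ 2
  have hQ1 : ∑ a, ∑ b, ∑ d, γ a b d * γ d b a = ∑ a, ∑ b, ∑ d, γ a b d * γ b a d := by
    rw [s23]
    refine Finset.sum_congr rfl fun a _ => Finset.sum_congr rfl fun b _ =>
      Finset.sum_congr rfl fun d _ => ?_
    rw [hγ a d b, hγ b d a]; ring
  have hQ2 : ∑ a, ∑ b, ∑ d, γ b a d * γ d b a = -∑ a, ∑ b, ∑ d, γ a b d * γ b a d := by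
    rw [s12, hQ1.symm, ← Finset.sum_neg_distrib]
    simp_rw [← Finset.sum_neg_distrib]
    refine Finset.sum_congr rfl fun a _ => Finset.sum_congr rfl fun b _ =>
      Finset.sum_congr rfl fun d _ => ?_
    rw [hγ d a b]; ring
  have hQ3 : ∑ a, ∑ b, ∑ d, γ b a d * γ a d b = -∑ a, ∑ b, ∑ d, γ a b d * γ b a d := by
    simp_rw [← Finset.sum_neg_distrib]
    refine Finset.sum_congr rfl fun a _ => Finset.sum_congr rfl fun b _ =>
      Finset.sum_congr rfl fun d _ => ?_
    rw [hγ a d b]; ring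
  have e1 : ∀ a b d, γ a b d * γ b a d - c a b d * γ d b a
      = γ a b d * γ b a d - γ a b d * γ d b a + γ b a d * γ d b a := by
    intro a b d; rw [hc]; ring
  have e2 : ∀ a b d, c a b d ^ 2
      = γ a b d ^ 2 + γ b a d ^ 2 - 2 * (γ a b d * γ b a d) := by
    intro a b d; rw [hc]; ring
  have e3 : ∀ a b d, c a b d * c a d b
      = -(γ a b d ^ 2) + γ a b d * γ d b a - γ b a d * γ a d b - γ b a d * γ d b a := by
    intro a b d; rw [hc, hc, hγ a d b, hγ d b a]; ring
  unfold structQuadratic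
  simp_rw [e1, e2, e3, Finset.sum_add_distrib, Finset.sum_sub_distrib, Finset.sum_add_distrib,
    ← Finset.mul_sum, Finset.sum_neg_distrib]
  rw [hP, hQ1, hQ2, hQ3]
  ring

/-! ### Connections on a vector space -/

section Connection

open VectorField

variable {E : Type*} [NormedAddCommGroup E] [NormedSpace ℝ E]

/-- The covariant derivative of the vector field `W` along `V`, for the connection with
coefficients `Γ`. -/
def covDeriv (Γ : E → E →L[ℝ] E →L[ℝ] E) (V W : E → E) (z : E) : E :=
  fderiv ℝ W z (V z) + Γ z (V z) (W z)

/-- The curvature tensor of the connection with coefficients `Γ`. -/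
def curvature (Γ : E → E →L[ℝ] E →L[ℝ] E) (y u v w : E) : E :=
  fderiv ℝ Γ y u v w - fderiv ℝ Γ y v u w + Γ y u (Γ y v w) - Γ y v (Γ y u w)

lemma fderiv_covDeriv {Γ : E → E →L[ℝ] E →L[ℝ] E} {W Z : E → E} {y : E}
    (hΓ : DifferentiableAt ℝ Γ y) (hW : DifferentiableAt ℝ W y) (hZ : ContDiffAt ℝ 2 Z y) (u : E) :
    fderiv ℝ (covDeriv Γ W Z) y u = fderiv ℝ (fderiv ℝ Z) y u (W y) + fderiv ℝ Z y (fderiv ℝ W y u)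
      + (fderiv ℝ Γ y u (W y) (Z y) + Γ y (fderiv ℝ W y u) (Z y)
        + Γ y (W y) (fderiv ℝ Z y u)) := by
  have hZ' : DifferentiableAt ℝ (fderiv ℝ Z) y :=
    (hZ.fderiv_right (m := 1) (by norm_num)).differentiableAt (by norm_num)
  have hZ1 : DifferentiableAt ℝ Z y := hZ.differentiableAt (by norm_num)
  have h1 := hZ'.hasFDerivAt.clm_apply hW.hasFDerivAt
  have h2 := (hΓ.hasFDerivAt.clm_apply hW.hasFDerivAt).clm_apply hZ1.hasFDerivAt
  have h3 := h1.add h2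
  have : covDeriv Γ W Z = fun z => fderiv ℝ Z z (W z) + Γ z (W z) (Z z) := rfl
  rw [this]
  erw [h3.fderiv]
  simp
  abel

/-- The second derivatives of `Z` cancel by symmetry, and the first-derivative terms are absorbed by
the bracket. -/
lemma ricci_identity {Γ : E → E →L[ℝ] E →L[ℝ] E} {V W Z : E → E} {y : E}
    (hΓ : DifferentiableAt ℝ Γ y) (hV : DifferentiableAt ℝ V y) (hW : DifferentiableAt ℝ W y)
    (hZ : ContDiffAt ℝ 2 Z y) :
    curvature Γ y (V y) (W y) (Z y) = covDeriv Γ V (covDeriv Γ W Z) y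
      - covDeriv Γ W (covDeriv Γ V Z) y - covDeriv Γ (lieBracket ℝ V W) Z y := by
  have hsymm : fderiv ℝ (fderiv ℝ Z) y (V y) (W y) = fderiv ℝ (fderiv ℝ Z) y (W y) (V y) :=
    (hZ.isSymmSndFDerivAt (by simp)) _ _
  rw [covDeriv, covDeriv, covDeriv, fderiv_covDeriv hΓ hW hZ, fderiv_covDeriv hΓ hV hZ, hsymm]
  simp only [covDeriv, curvature, lieBracket, map_add, map_sub, sub_apply]
  abel

lemma covDeriv_sub_covDeriv {Γ : E → E →L[ℝ] E →L[ℝ] E} {V W : E → E} {z : E}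
    (hsymm : ∀ u v, Γ z u v = Γ z v u) :
    covDeriv Γ V W z - covDeriv Γ W V z = lieBracket ℝ V W z := by
  rw [covDeriv, covDeriv, lieBracket, hsymm (W z)]; abel

lemma fderiv_metric_apply {B : E → E →L[ℝ] E →L[ℝ] ℝ} {Γ : E → E →L[ℝ] E →L[ℝ] E}
    {V P Q : E → E} {z : E} (hB : DifferentiableAt ℝ B z)
    (hcompat : ∀ u v w, fderiv ℝ B z u v w = B z (Γ z u v) w + B z v (Γ z u w))
    (hP : DifferentiableAt ℝ P z) (hQ : DifferentiableAt ℝ Q z) :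
    fderiv ℝ (fun x => B x (P x) (Q x)) z (V z)
      = B z (covDeriv Γ V P z) (Q z) + B z (P z) (covDeriv Γ V Q z) := by
  rw [((hB.hasFDerivAt.clm_apply hP.hasFDerivAt).clm_apply hQ.hasFDerivAt).fderiv]
  simp [covDeriv, hcompat]
  ring

end Connection

/-! ### Scalar curvature from an orthonormal frame -/

section FrameFormula

open VectorField

variable {E : Type*} [NormedAddCommGroup E] [NormedSpace ℝ E] {ι : Type*} [Fintype ι]
  [DecidableEq ι]

/-- The scalar curvature of a metric connection without torsion, in terms of the structure
coefficients of an orthonormal frame. -/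
theorem sum_curvature_eq {V : Set E} (hV : IsOpen V) {B : E → E →L[ℝ] E →L[ℝ] ℝ}
    {Γ : E → E →L[ℝ] E →L[ℝ] E} {e : ι → E → E} (hB : ContDiffOn ℝ ∞ B V)
    (hΓ : ContDiffOn ℝ ∞ Γ V) (he : ∀ a, ContDiffOn ℝ ∞ (e a) V)
    (hΓsymm : ∀ z ∈ V, ∀ u v, Γ z u v = Γ z v u)
    (hcompat : ∀ z ∈ V, ∀ u v w, fderiv ℝ B z u v w = B z (Γ z u v) w + B z v (Γ z u w))
    (hBsymm : ∀ z ∈ V, ∀ u v, B z u v = B z v u)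
    (horth : ∀ z ∈ V, ∀ a b, B z (e a z) (e b z) = if a = b then 1 else 0)
    (hexp : ∀ z ∈ V, ∀ v, v = ∑ a, B z v (e a z) • e a z) {y : E} (hy : y ∈ V) :
    ∑ a, ∑ b, B y (curvature Γ y (e a y) (e b y) (e b y)) (e a y)
      = ∑ a, (2 * fderiv ℝ (fun z => ∑ b, B z (lieBracket ℝ (e a) (e b) z) (e b z)) y (e a y)
          - (∑ b, B y (lieBracket ℝ (e a) (e b) y) (e b y)) ^ 2)
        + structQuadratic fun a b d => B y (lieBracket ℝ (e a) (e b) y) (e d y) := by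
  set N : ι → ι → E → E := fun a b => covDeriv Γ (e a) (e b) with hN
  set γ : ι → ι → ι → E → ℝ := fun a b d z => B z (N a b z) (e d z) with hγdef
  have hnhds : ∀ z ∈ V, V ∈ nhds z := fun z hz => hV.mem_nhds hz
  have hBd : ∀ z ∈ V, DifferentiableAt ℝ B z := fun z hz =>
    ((hB.contDiffAt (hnhds z hz)).differentiableAt (by simp))
  have hΓd : ∀ z ∈ V, DifferentiableAt ℝ Γ z := fun z hz =>
    ((hΓ.contDiffAt (hnhds z hz)).differentiableAt (by simp))
  have hed : ∀ a, ∀ z ∈ V, DifferentiableAt ℝ (e a) z := fun a z hz =>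
    (((he a).contDiffAt (hnhds z hz)).differentiableAt (by simp))
  have hNs : ∀ a b, ContDiffOn ℝ ∞ (N a b) V := fun a b =>
    (((he b).fderiv_of_isOpen hV (m := ∞) (by simp)).clm_apply (he a)).add
      ((hΓ.clm_apply (he a)).clm_apply (he b))
  have hNd : ∀ a b, ∀ z ∈ V, DifferentiableAt ℝ (N a b) z := fun a b z hz =>
    (((hNs a b).contDiffAt (hnhds z hz)).differentiableAt (by simp))
  have hγd : ∀ a b d, ∀ z ∈ V, DifferentiableAt ℝ (γ a b d) z := fun a b d z hz =>
    ((hBd z hz).clm_apply (hNd a b z hz)).clm_apply (hed d z hz)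
  -- Orthonormality makes `B(e_b, e_d)` locally constant; differentiate it along `e_a`.
  have hγanti : ∀ z ∈ V, ∀ a b d, γ a b d z = -γ a d b z := by
    intro z hz a b d
    have h := fderiv_metric_apply (V := e a) (hBd z hz) (hcompat z hz) (hed b z hz) (hed d z hz)
    have h0 : (fun x => B x (e b x) (e d x)) =ᶠ[nhds z] fun _ => if b = d then 1 else 0 := by
      filter_upwards [hnhds z hz] with x hx using horth x hx b d
    rw [h0.fderiv_eq, hBsymm z hz (e b z)] at h
    simp only [fderiv_fun_const, Pi.zero_apply, zero_apply] at h
    simp only [hγdef, hN]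
    linarith
  have htors : ∀ z ∈ V, ∀ a b, lieBracket ℝ (e a) (e b) z = N a b z - N b a z :=
    fun z hz a b => (covDeriv_sub_covDeriv (hΓsymm z hz)).symm
  have hc : ∀ z ∈ V, ∀ a b d,
      B z (lieBracket ℝ (e a) (e b) z) (e d z) = γ a b d z - γ b a d z := by
    intro z hz a b d
    simp [htors z hz, hγdef]
  have hdiag : ∀ z ∈ V, ∀ a b, γ a b b z = 0 := fun z hz a b => by
    have := hγanti z hz a b b
    linarith
  set H : ι → E → ℝ := fun a z => ∑ b, γ b b a z with hH
  have hHd : ∀ a, DifferentiableAt ℝ (H a) y := fun a =>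
    DifferentiableAt.fun_sum fun b _ => hγd b b a y hy
  have hcH : ∀ z ∈ V, ∀ a, ∑ b, B z (lieBracket ℝ (e a) (e b) z) (e b z) = H a z := by
    intro z hz a
    refine Finset.sum_congr rfl fun b _ => ?_
    rw [hc z hz, hdiag z hz a b, hγanti z hz b b a]; ring
  have hfd : ∀ a, fderiv ℝ (fun z => ∑ b, B z (lieBracket ℝ (e a) (e b) z) (e b z)) y
      = fderiv ℝ (H a) y := fun a => Filter.EventuallyEq.fderiv_eq (by
    filter_upwards [hnhds y hy] with z hz using hcH z hz a)
  have hparseval : ∀ u v, B y u v = ∑ d, B y u (e d y) * B y v (e d y) := by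
    intro u v
    conv_lhs => rw [hexp y hy v]
    simp [mul_comm]
  -- The product rule moves the outer covariant derivatives off the inner product, and Parseval
  -- expands the resulting products of first covariant derivatives in the frame.
  have hterm : ∀ a b, B y (curvature Γ y (e a y) (e b y) (e b y)) (e a y)
      = fderiv ℝ (γ b b a) y (e a y) - fderiv ℝ (γ a b a) y (e b y)
        - ∑ d, γ b b d y * γ a a d y
        + ∑ d, (γ a b d y * γ b a d y - (γ a b d y - γ b a d y) * γ d b a y) := by
    intro a b
    have h1 : fderiv ℝ (γ b b a) y (e a y) = _ :=
      fderiv_metric_apply (V := e a) (hBd y hy) (hcompat y hy) (hNd b b y hy) (hed a y hy)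
    have h2 : fderiv ℝ (γ a b a) y (e b y) = _ :=
      fderiv_metric_apply (V := e b) (hBd y hy) (hcompat y hy) (hNd a b y hy) (hed a y hy)
    have h3 : covDeriv Γ (lieBracket ℝ (e a) (e b)) (e b) y
        = ∑ d, (γ a b d y - γ b a d y) • N d b y := by
      rw [covDeriv, hexp y hy (lieBracket ℝ (e a) (e b) y)]
      simp only [map_sum, map_smul, FunLike.coe_sum, Finset.sum_apply,
        FunLike.coe_smul, Pi.smul_apply, ← Finset.sum_add_distrib, ← smul_add,
        hc y hy]
      rfl
    have h4 := hparseval (N b b y) (N a a y)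
    have h5 := hparseval (N a b y) (N b a y)
    rw [ricci_identity (hΓd y hy) (hed a y hy) (hed b y hy)
      (((he b).contDiffAt (hnhds y hy)).of_le (by norm_cast)), h3]
    simp only [map_sub, map_sum, map_smul, FunLike.coe_sum, Finset.sum_apply,
      sub_apply, FunLike.coe_smul, Pi.smul_apply, smul_eq_mul]
    rw [Finset.sum_sub_distrib]
    change B y (covDeriv Γ (e a) (N b b) y) (e a y) - B y (covDeriv Γ (e b) (N a b) y) (e a y)
      - ∑ d, (γ a b d y - γ b a d y) * γ d b a y = _
    change B y (N b b y) (N a a y) = ∑ d, γ b b d y * γ a a d y at h4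
    change B y (N a b y) (N b a y) = ∑ d, γ a b d y * γ b a d y at h5
    change _ = _ + B y (N b b y) (N a a y) at h1
    change _ = _ + B y (N a b y) (N b a y) at h2
    linarith
  have hD1 : ∑ a, ∑ b, fderiv ℝ (γ b b a) y (e a y) = ∑ a, fderiv ℝ (H a) y (e a y) := by
    refine Finset.sum_congr rfl fun a _ => ?_
    rw [hH, fderiv_fun_sum fun b _ => hγd b b a y hy]
    simp
  -- Antisymmetry turns this sum into minus the previous one, which produces the factor 2 in the
  -- formula.
  have hD2 : ∑ a, ∑ b, fderiv ℝ (γ a b a) y (e b y) = -∑ a, fderiv ℝ (H a) y (e a y) := by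
    rw [← hD1, Finset.sum_comm, ← Finset.sum_neg_distrib]
    refine Finset.sum_congr rfl fun a _ => ?_
    rw [← Finset.sum_neg_distrib]
    refine Finset.sum_congr rfl fun b _ => ?_
    have : γ b a b =ᶠ[nhds y] fun z => -γ b b a z := by
      filter_upwards [hnhds y hy] with z hz using hγanti z hz b a b
    rw [this.fderiv_eq, fderiv_fun_neg]
    simp
  have hD3 : ∑ a, ∑ b, ∑ d, γ b b d y * γ a a d y = ∑ d, H d y ^ 2 := by
    simp_rw [hH, sq, Finset.sum_mul_sum]
    rw [Finset.sum_comm]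
    rw [Finset.sum_congr rfl fun b _ => Finset.sum_comm, Finset.sum_comm]
  simp_rw [hterm, hfd, hcH y hy, Finset.sum_add_distrib, Finset.sum_sub_distrib]
  rw [hD1, hD2, hD3, ← Finset.mul_sum]
  have := sum_connection_eq_structQuadratic (fun a b d => γ a b d y)
    (fun a b d => B y (lieBracket ℝ (e a) (e b) y) (e d y)) (hγanti y hy) (hc y hy)
  simp_rw [hc y hy, Finset.sum_sub_distrib] at this
  simp_rw [hc y hy, ← this]
  ring

end FrameFormula

/-! ### Coordinate metrics and their Levi-Civita connection -/

section Coordinates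

open VectorField

variable {m : ℕ}

lemma eq_sum_single (u : EuclideanSpace ℝ (Fin m)) :
    u = ∑ k, u k • EuclideanSpace.single k (1 : ℝ) := by
  conv_lhs => rw [← (EuclideanSpace.basisFun (Fin m) ℝ).sum_repr u]
  simp

/-- The bilinear form with coefficient matrix `G`. -/
def metricForm (G : EuclideanSpace ℝ (Fin m) → Matrix (Fin m) (Fin m) ℝ)
    (z : EuclideanSpace ℝ (Fin m)) :
    EuclideanSpace ℝ (Fin m) →L[ℝ] EuclideanSpace ℝ (Fin m) →L[ℝ] ℝ :=
  ∑ i, ∑ j, G z i j • (EuclideanSpace.proj i : EuclideanSpace ℝ (Fin m) →L[ℝ] ℝ).smulRight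
    (EuclideanSpace.proj j : EuclideanSpace ℝ (Fin m) →L[ℝ] ℝ)

/-- The Levi-Civita connection coefficients as a bilinear map. -/
def christoffelForm (G : EuclideanSpace ℝ (Fin m) → Matrix (Fin m) (Fin m) ℝ)
    (z : EuclideanSpace ℝ (Fin m)) : EuclideanSpace ℝ (Fin m) →L[ℝ]
      EuclideanSpace ℝ (Fin m) →L[ℝ] EuclideanSpace ℝ (Fin m) :=
  ∑ k, ∑ i, ∑ j, christoffel G k i j z •
    (EuclideanSpace.proj i : EuclideanSpace ℝ (Fin m) →L[ℝ] ℝ).smulRight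
      ((EuclideanSpace.proj j : EuclideanSpace ℝ (Fin m) →L[ℝ] ℝ).smulRight
        (EuclideanSpace.single k (1 : ℝ)))

variable {G : EuclideanSpace ℝ (Fin m) → Matrix (Fin m) (Fin m) ℝ}

lemma metricForm_apply (z u v : EuclideanSpace ℝ (Fin m)) :
    metricForm G z u v = ∑ i, ∑ j, G z i j * (u i * v j) := by
  simp [metricForm]

lemma metricForm_single (z : EuclideanSpace ℝ (Fin m)) (i j : Fin m) :
    metricForm G z (EuclideanSpace.single i 1) (EuclideanSpace.single j 1) = G z i j := by
  simp [metricForm_apply]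

lemma christoffelForm_apply (z u v : EuclideanSpace ℝ (Fin m)) (p : Fin m) :
    christoffelForm G z u v p = ∑ i, ∑ j, christoffel G p i j z * (u i * v j) := by
  simp [christoffelForm, Pi.single_apply]

lemma christoffelForm_single (z : EuclideanSpace ℝ (Fin m)) (i j p : Fin m) :
    christoffelForm G z (EuclideanSpace.single i 1) (EuclideanSpace.single j 1) p
      = christoffel G p i j z := by
  simp [christoffelForm_apply]

lemma contDiffOn_smul_const {E F : Type*} [NormedAddCommGroup E] [NormedSpace ℝ E]
    [NormedAddCommGroup F] [NormedSpace ℝ F] {f : E → ℝ} {V : Set E} (hf : ContDiffOn ℝ ∞ f V)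
    (c : F) : ContDiffOn ℝ ∞ (fun z => f z • c) V :=
  hf.smul contDiffOn_const

lemma contDiffOn_metricForm {V : Set (EuclideanSpace ℝ (Fin m))}
    (hG : ∀ i j, ContDiffOn ℝ ∞ (fun z => G z i j) V) : ContDiffOn ℝ ∞ (metricForm G) V := by
  unfold metricForm
  exact ContDiffOn.sum fun i _ => ContDiffOn.sum fun j _ => 
    contDiffOn_smul_const (hG i j) _

lemma contDiffOn_christoffelForm {V : Set (EuclideanSpace ℝ (Fin m))}
    (hG : ∀ k i j, ContDiffOn ℝ ∞ (christoffel G k i j) V) :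
    ContDiffOn ℝ ∞ (christoffelForm G) V := by
  unfold christoffelForm
  exact ContDiffOn.sum fun k _ => ContDiffOn.sum fun i _ => ContDiffOn.sum fun j _ =>
    contDiffOn_smul_const (hG k i j) _

lemma fderiv_metricForm_single {z : EuclideanSpace ℝ (Fin m)}
    (h : DifferentiableAt ℝ (metricForm G) z) (u : EuclideanSpace ℝ (Fin m)) (i j : Fin m) :
    fderiv ℝ (metricForm G) z u (EuclideanSpace.single i 1) (EuclideanSpace.single j 1)
      = fderiv ℝ (fun x => G x i j) z u := by
  simp_rw [← metricForm_single (G := G)]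
  rw [((h.hasFDerivAt.clm_apply (hasFDerivAt_const _ _)).clm_apply
    (hasFDerivAt_const _ _)).fderiv]
  simp

lemma fderiv_christoffelForm_single {z : EuclideanSpace ℝ (Fin m)}
    (h : DifferentiableAt ℝ (christoffelForm G) z) (u : EuclideanSpace ℝ (Fin m))
    (i j p : Fin m) :
    fderiv ℝ (christoffelForm G) z u (EuclideanSpace.single i 1) (EuclideanSpace.single j 1) p
      = fderiv ℝ (christoffel G p i j) z u := by
  have : christoffel G p i j = fun z => (EuclideanSpace.proj p : _ →L[ℝ] ℝ)
      (christoffelForm G z (EuclideanSpace.single i 1) (EuclideanSpace.single j 1)) := by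
    ext z; exact (christoffelForm_single z i j p).symm
  rw [this]
  have h2 := ((h.hasFDerivAt.clm_apply (hasFDerivAt_const (EuclideanSpace.single i (1 : ℝ)) z)).clm_apply
    (hasFDerivAt_const (EuclideanSpace.single j (1 : ℝ)) z))
  have h3 := (EuclideanSpace.proj p : EuclideanSpace ℝ (Fin m) →L[ℝ] ℝ).hasFDerivAt.comp z h2
  change _ = fderiv ℝ ((EuclideanSpace.proj p : EuclideanSpace ℝ (Fin m) →L[ℝ] ℝ) ∘ fun z =>
    christoffelForm G z (EuclideanSpace.single i 1) (EuclideanSpace.single j 1)) z u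
  rw [h3.fderiv]
  simp

/-- Trilinear forms which agree on the standard basis are equal. -/
lemma trilinear_ext {T T' : EuclideanSpace ℝ (Fin m) →L[ℝ] EuclideanSpace ℝ (Fin m) →L[ℝ]
      EuclideanSpace ℝ (Fin m) →L[ℝ] ℝ}
    (h : ∀ i j k, T (EuclideanSpace.single i 1) (EuclideanSpace.single j 1)
      (EuclideanSpace.single k 1) = T' (EuclideanSpace.single i 1) (EuclideanSpace.single j 1)
      (EuclideanSpace.single k 1)) : T = T' := by
  ext u v w
  rw [eq_sum_single u, eq_sum_single v, eq_sum_single w]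
  simp [h]

lemma lower_christoffel {z : EuclideanSpace ℝ (Fin m)} (hdet : IsUnit (G z).det)
    (i j k : Fin m) :
    ∑ p, G z k p * christoffel G p i j z = (1 / 2 : ℝ) *
      (partialDeriv i (fun z => G z j k) z + partialDeriv j (fun z => G z i k) z
      - partialDeriv k (fun z => G z i j) z) := by
  have h1 : ∀ l, ∑ p, G z k p * (G z)⁻¹ p l = if k = l then 1 else 0 := by
    intro l
    have := congrFun (congrFun (Matrix.mul_nonsing_inv (G z) hdet) k) l
    rwa [Matrix.mul_apply, Matrix.one_apply] at this
  simp only [christoffel, Finset.mul_sum]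
  rw [Finset.sum_comm]
  have h2 : ∀ l, ∑ p, G z k p * ((1 / 2 : ℝ) * ((G z)⁻¹ p l *
      (partialDeriv i (fun z => G z j l) z + partialDeriv j (fun z => G z i l) z
      - partialDeriv l (fun z => G z i j) z))) = (if k = l then 1 else 0) * ((1 / 2 : ℝ) *
      (partialDeriv i (fun z => G z j l) z + partialDeriv j (fun z => G z i l) z
      - partialDeriv l (fun z => G z i j) z)) := by
    intro l
    rw [← h1, Finset.sum_mul]
    exact Finset.sum_congr rfl fun p _ => by ring
  rw [Finset.sum_congr rfl fun l _ => h2 l]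
  simp

/-- Both sides are trilinear, so the standard basis suffices. There the right side is a sum of two
lowered Christoffel symbols, in which all but one partial derivative of `G` cancels by symmetry of
`G`. -/
lemma fderiv_metricForm_eq {V : Set (EuclideanSpace ℝ (Fin m))} (hV : IsOpen V)
    (hG : ∀ i j, ContDiffOn ℝ ∞ (fun z => G z i j) V) (hsymm : ∀ z ∈ V, (G z).IsSymm)
    {z : EuclideanSpace ℝ (Fin m)} (hz : z ∈ V) (hdet : IsUnit (G z).det)
    (u v w : EuclideanSpace ℝ (Fin m)) :
    fderiv ℝ (metricForm G) z u v w = metricForm G z (christoffelForm G z u v) w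
      + metricForm G z v (christoffelForm G z u w) := by
  have hd : DifferentiableAt ℝ (metricForm G) z :=
    ((contDiffOn_metricForm hG).contDiffAt (hV.mem_nhds hz)).differentiableAt (by simp)
  have hBs : ∀ a b, metricForm G z a b = metricForm G z b a := by
    intro a b
    simp only [metricForm_apply]
    rw [Finset.sum_comm]
    exact Finset.sum_congr rfl fun i _ => Finset.sum_congr rfl fun j _ => by
      rw [(hsymm z hz).apply]; ring
  have hpd : ∀ k i j, partialDeriv k (fun x => G x i j) z = partialDeriv k (fun x => G x j i) z := by
    intro k i j
    unfold partialDeriv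
    rw [Filter.EventuallyEq.fderiv_eq]
    filter_upwards [hV.mem_nhds hz] with x hx using (hsymm x hx).apply j i
  set T := ((ContinuousLinearMap.compL ℝ (EuclideanSpace ℝ (Fin m)) (EuclideanSpace ℝ (Fin m))
    (EuclideanSpace ℝ (Fin m) →L[ℝ] ℝ)) (metricForm G z)).comp (christoffelForm G z) with hT
  have hTa : ∀ a b c, T a b c = metricForm G z (christoffelForm G z a b) c := fun a b c => rfl
  set T' := ((ContinuousLinearMap.flipₗᵢ ℝ (EuclideanSpace ℝ (Fin m)) (EuclideanSpace ℝ (Fin m))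
    ℝ).toContinuousLinearEquiv.toContinuousLinearMap).comp T
  have hTa' : ∀ a b c, T' a b c = metricForm G z b (christoffelForm G z a c) := fun a b c => by
    rw [hBs]; rfl
  have key : fderiv ℝ (metricForm G) z = T + T' := by
    apply trilinear_ext
    intro k i j
    have hlow : ∀ a b c, metricForm G z (EuclideanSpace.single c 1)
        (christoffelForm G z (EuclideanSpace.single a 1) (EuclideanSpace.single b 1))
        = ∑ p, G z c p * christoffel G p a b z := by
      intro a b c
      simp [metricForm_apply, christoffelForm_single]
    rw [fderiv_metricForm_single hd, add_apply, add_apply, add_apply, hTa, hTa', hBs, hlow, hlow,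
      lower_christoffel hdet, lower_christoffel hdet]
    rw [hpd k j i, hpd j k i, hpd i k j]
    change partialDeriv k (fun x => G x i j) z = _
    ring
  rw [key, add_apply, add_apply, add_apply, hTa, hTa']

end Coordinates

/-! ### From the coordinate formula to the frame formula -/

section CoordinateFrame

open VectorField

variable {m : ℕ} {G : EuclideanSpace ℝ (Fin m) → Matrix (Fin m) (Fin m) ℝ}

/-- Setting `p = i` and summing over `i` gives exactly `coordRicci`. -/
lemma curvature_single {y : EuclideanSpace ℝ (Fin m)}
    (h : DifferentiableAt ℝ (christoffelForm G) y) (i j k p : Fin m) :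
    curvature (christoffelForm G) y (EuclideanSpace.single i 1) (EuclideanSpace.single j 1)
      (EuclideanSpace.single k 1) p = partialDeriv i (christoffel G p j k) y
        - partialDeriv j (christoffel G p i k) y
        + ∑ q, (christoffel G p i q y * christoffel G q j k y
          - christoffel G p j q y * christoffel G q i k y) := by
  have h1 : ∀ a b c, christoffelForm G y (EuclideanSpace.single a 1) (christoffelForm G y
      (EuclideanSpace.single b 1) (EuclideanSpace.single c 1)) p
      = ∑ q, christoffel G p a q y * christoffel G q b c y := by
    intro a b c
    rw [christoffelForm_apply]
    simp [christoffelForm_single]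
  rw [curvature, PiLp.sub_apply, PiLp.add_apply, PiLp.sub_apply, fderiv_christoffelForm_single h,
    fderiv_christoffelForm_single h, h1, h1, Finset.sum_sub_distrib]
  simp only [partialDeriv]
  ring

lemma curvature_sum_left {Γ : EuclideanSpace ℝ (Fin m) → EuclideanSpace ℝ (Fin m) →L[ℝ]
      EuclideanSpace ℝ (Fin m) →L[ℝ] EuclideanSpace ℝ (Fin m)}
    (y u v w : EuclideanSpace ℝ (Fin m)) :
    curvature Γ y u v w = ∑ i, u i • curvature Γ y (EuclideanSpace.single i 1) v w := by
  conv_lhs => rw [eq_sum_single u]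
  simp only [curvature, map_sum, map_smul, FunLike.coe_sum, Finset.sum_apply,
    FunLike.coe_smul, Pi.smul_apply, smul_sub, smul_add, Finset.sum_sub_distrib,
    Finset.sum_add_distrib]

lemma curvature_sum_middle {Γ : EuclideanSpace ℝ (Fin m) → EuclideanSpace ℝ (Fin m) →L[ℝ]
      EuclideanSpace ℝ (Fin m) →L[ℝ] EuclideanSpace ℝ (Fin m)}
    (y u v w : EuclideanSpace ℝ (Fin m)) :
    curvature Γ y u v w = ∑ i, v i • curvature Γ y u (EuclideanSpace.single i 1) w := by
  conv_lhs => rw [eq_sum_single v]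
  simp only [curvature, map_sum, map_smul, FunLike.coe_sum, Finset.sum_apply,
    FunLike.coe_smul, Pi.smul_apply, smul_sub, smul_add, Finset.sum_sub_distrib,
    Finset.sum_add_distrib]

lemma curvature_sum_right {Γ : EuclideanSpace ℝ (Fin m) → EuclideanSpace ℝ (Fin m) →L[ℝ]
      EuclideanSpace ℝ (Fin m) →L[ℝ] EuclideanSpace ℝ (Fin m)}
    (y u v w : EuclideanSpace ℝ (Fin m)) :
    curvature Γ y u v w = ∑ i, w i • curvature Γ y u v (EuclideanSpace.single i 1) := by
  conv_lhs => rw [eq_sum_single w]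
  simp only [curvature, map_sum, map_smul, smul_sub, smul_add, Finset.sum_sub_distrib,
    Finset.sum_add_distrib]

/-- The matrix whose columns are the given frame vectors. -/
def frameMatrix (e : Fin m → EuclideanSpace ℝ (Fin m)) : Matrix (Fin m) (Fin m) ℝ :=
  Matrix.of fun i a => e a i

/-- Orthonormality says `Eᵀ G E = 1`. One-sided inverses of square matrices are two-sided, so `E Eᵀ`
is the inverse of `G`; this lets contractions with `G⁻¹` be replaced by sums over the frame. -/
lemma frameMatrix_mul_transpose_mul {z : EuclideanSpace ℝ (Fin m)}
    {e : Fin m → EuclideanSpace ℝ (Fin m)}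
    (horth : ∀ a b, metricForm G z (e a) (e b) = if a = b then 1 else 0) :
    frameMatrix e * (frameMatrix e).transpose * G z = 1 := by
  have h : (frameMatrix e).transpose * G z * frameMatrix e = 1 := by
    ext a b
    rw [Matrix.one_apply, ← horth a b, metricForm_apply, Matrix.mul_apply]
    simp only [Matrix.mul_apply, frameMatrix, Matrix.transpose_apply, Matrix.of_apply,
      Finset.sum_mul]
    rw [Finset.sum_comm]
    exact Finset.sum_congr rfl fun i _ => Finset.sum_congr rfl fun j _ => by ring
  rw [Matrix.mul_assoc]
  exact mul_eq_one_comm.mp h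

lemma inv_apply_eq_sum_frame {z : EuclideanSpace ℝ (Fin m)}
    {e : Fin m → EuclideanSpace ℝ (Fin m)}
    (horth : ∀ a b, metricForm G z (e a) (e b) = if a = b then 1 else 0) (i j : Fin m) :
    (G z)⁻¹ i j = ∑ a, e a i * e a j := by
  rw [Matrix.inv_eq_left_inv (frameMatrix_mul_transpose_mul horth), Matrix.mul_apply]
  simp [frameMatrix]

lemma eq_sum_frame {z : EuclideanSpace ℝ (Fin m)} (hsymm : (G z).IsSymm)
    {e : Fin m → EuclideanSpace ℝ (Fin m)}
    (horth : ∀ a b, metricForm G z (e a) (e b) = if a = b then 1 else 0)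
    (v : EuclideanSpace ℝ (Fin m)) : v = ∑ a, metricForm G z v (e a) • e a := by
  ext i
  have h := congrArg (fun A => Matrix.mulVec A v.ofLp i) (frameMatrix_mul_transpose_mul horth)
  simp only [Matrix.one_mulVec] at h
  rw [← h, ← Matrix.mulVec_mulVec, ← Matrix.mulVec_mulVec, Matrix.mulVec_eq_sum]
  simp only [WithLp.ofLp_sum, WithLp.ofLp_smul, Finset.sum_apply, Pi.smul_apply, op_smul_eq_smul,
    smul_eq_mul]
  refine Finset.sum_congr rfl fun a _ => ?_
  congr 1
  rw [metricForm_apply, Finset.sum_comm]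
  simp only [Matrix.mulVec, dotProduct, Finset.mul_sum]
  refine Finset.sum_congr rfl fun p _ => Finset.sum_congr rfl fun q _ => ?_
  rw [hsymm.apply p q, Matrix.transpose_apply, frameMatrix, Matrix.of_apply]
  ring

/-- The scalar curvature in terms of the structure coefficients of an orthonormal frame. -/
theorem coordScalar_eq_of_frame {V : Set (EuclideanSpace ℝ (Fin m))} (hV : IsOpen V)
    (hG : ∀ i j, ContDiffOn ℝ ∞ (fun z => G z i j) V) (hsymm : ∀ z ∈ V, (G z).IsSymm)
    {e : Fin m → EuclideanSpace ℝ (Fin m) → EuclideanSpace ℝ (Fin m)}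
    (he : ∀ a, ContDiffOn ℝ ∞ (e a) V)
    (horth : ∀ z ∈ V, ∀ a b, metricForm G z (e a z) (e b z) = if a = b then 1 else 0)
    {y : EuclideanSpace ℝ (Fin m)} (hy : y ∈ V) :
    coordScalar G y
      = ∑ a, (2 * fderiv ℝ (fun z => ∑ b,
            metricForm G z (lieBracket ℝ (e a) (e b) z) (e b z)) y (e a y)
          - (∑ b, metricForm G y (lieBracket ℝ (e a) (e b) y) (e b y)) ^ 2)
        + structQuadratic fun a b d => metricForm G y (lieBracket ℝ (e a) (e b) y) (e d y) := by
  have hcomp : ∀ a i, ContDiffOn ℝ ∞ (fun z => e a z i) V := fun a i =>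
    (EuclideanSpace.proj i : EuclideanSpace ℝ (Fin m) →L[ℝ] ℝ).contDiff.comp_contDiffOn (he a)
  -- The frame expression for `G⁻¹` yields its smoothness for free.
  have hinv : ∀ k l, ContDiffOn ℝ ∞ (fun z => (G z)⁻¹ k l) V := fun k l =>
    (ContDiffOn.sum fun a _ => (hcomp a k).mul (hcomp a l)).congr fun z hz =>
      inv_apply_eq_sum_frame (horth z hz) k l
  have hpd : ∀ k i j, ContDiffOn ℝ ∞ (partialDeriv k fun x => G x i j) V := fun k i j =>
    ((hG i j).fderiv_of_isOpen hV (m := ∞) (by simp)).clm_apply contDiffOn_const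
  have hchr : ∀ k i j, ContDiffOn ℝ ∞ (christoffel G k i j) V := fun k i j =>
    contDiffOn_const.mul (ContDiffOn.sum fun l _ => (hinv k l).mul
      (((hpd i j l).add (hpd j i l)).sub (hpd l i j)))
  have hΓ := contDiffOn_christoffelForm hchr
  have hdet : ∀ z ∈ V, IsUnit (G z).det := fun z hz =>
    Matrix.isUnit_det_of_left_inverse (frameMatrix_mul_transpose_mul (horth z hz))
  have hGs : ∀ z ∈ V, ∀ i j, G z i j = G z j i := fun z hz i j => (hsymm z hz).apply j i
  have hΓsymm : ∀ z ∈ V, ∀ u v, christoffelForm G z u v = christoffelForm G z v u := by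
    intro z hz u v
    have hc : ∀ p i j, christoffel G p i j z = christoffel G p j i z := by
      intro p i j
      have : ∀ l, partialDeriv l (fun x => G x i j) z = partialDeriv l (fun x => G x j i) z := by
        intro l
        unfold partialDeriv
        rw [Filter.EventuallyEq.fderiv_eq]
        filter_upwards [hV.mem_nhds hz] with x hx using hGs x hx i j
      simp only [christoffel, this]
      congr 1
      exact Finset.sum_congr rfl fun l _ => by ring
    ext p
    rw [christoffelForm_apply, christoffelForm_apply, Finset.sum_comm]
    exact Finset.sum_congr rfl fun i _ => Finset.sum_congr rfl fun j _ => by rw [hc]; ring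
  have hBsymm : ∀ z ∈ V, ∀ u v, metricForm G z u v = metricForm G z v u := by
    intro z hz u v
    rw [metricForm_apply, metricForm_apply, Finset.sum_comm]
    exact Finset.sum_congr rfl fun i _ => Finset.sum_congr rfl fun j _ => by
      rw [hGs z hz]; ring
  rw [← sum_curvature_eq hV (contDiffOn_metricForm hG) hΓ he hΓsymm
    (fun z hz => fderiv_metricForm_eq hV hG hsymm hz (hdet z hz)) hBsymm horth
    (fun z hz => eq_sum_frame (hsymm z hz) (horth z hz)) hy]
  have hΓd : DifferentiableAt ℝ (christoffelForm G) y :=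
    (hΓ.contDiffAt (hV.mem_nhds hy)).differentiableAt (by simp)
  -- The trace of an endomorphism is the same in the orthonormal frame and in the coordinate basis.
  have htrace : ∀ v w, ∑ a, metricForm G y (curvature (christoffelForm G) y (e a y) v w) (e a y)
      = ∑ i, curvature (christoffelForm G) y (EuclideanSpace.single i 1) v w i := by
    intro v w
    have h1 : ∀ i, curvature (christoffelForm G) y (EuclideanSpace.single i 1) v w i
        = ∑ a, metricForm G y (curvature (christoffelForm G) y (EuclideanSpace.single i 1) v w)
          (e a y) * e a y i := by
      intro i
      conv_lhs => rw [eq_sum_frame (hsymm y hy) (horth y hy)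
        (curvature (christoffelForm G) y (EuclideanSpace.single i 1) v w)]
      simp
    simp_rw [h1]
    rw [Finset.sum_comm]
    refine Finset.sum_congr rfl fun a _ => ?_
    rw [curvature_sum_left y (e a y)]
    simp [mul_comm]
  have hricci : ∀ j k, ∑ i, curvature (christoffelForm G) y (EuclideanSpace.single i 1)
      (EuclideanSpace.single j 1) (EuclideanSpace.single k 1) i = coordRicci G j k y := by
    intro j k
    simp_rw [curvature_single hΓd, coordRicci, Finset.sum_add_distrib]
  rw [Finset.sum_comm]
  simp_rw [htrace]
  have hbil : ∀ b, ∑ i, curvature (christoffelForm G) y (EuclideanSpace.single i 1) (e b y)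
      (e b y) i = ∑ j, ∑ k, e b y j * e b y k * coordRicci G j k y := by
    intro b
    simp_rw [← hricci, Finset.mul_sum]
    rw [Finset.sum_congr rfl fun j _ => Finset.sum_comm, Finset.sum_comm]
    refine Finset.sum_congr rfl fun i _ => ?_
    rw [curvature_sum_middle]
    simp only [WithLp.ofLp_sum, WithLp.ofLp_smul, Finset.sum_apply, Pi.smul_apply, smul_eq_mul]
    refine Finset.sum_congr rfl fun j _ => ?_
    rw [curvature_sum_right]
    simp only [WithLp.ofLp_sum, WithLp.ofLp_smul, Finset.sum_apply, Pi.smul_apply, smul_eq_mul,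
      Finset.mul_sum, mul_assoc]
  simp_rw [hbil, coordScalar, inv_apply_eq_sum_frame (horth y hy), Finset.sum_mul]
  rw [Finset.sum_congr rfl fun j _ => Finset.sum_comm, Finset.sum_comm]

end CoordinateFrame

/-! ### Brackets of related vector fields -/

section RelatedFields

open VectorField Set

/-- Differentiating the relation `Dj(Z) = Z' ∘ j` leaves a second derivative of `j`, which is
symmetric and drops out of the commutator. No injectivity or surjectivity of `Dj` is involved, so
the lemma covers immersed leaves. -/
lemma fderiv_lieBracket_of_related {E E' : Type*} [NormedAddCommGroup E] [NormedSpace ℝ E]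
    [NormedAddCommGroup E'] [NormedSpace ℝ E'] {j : E → E'} {X Y : E → E} {X' Y' : E' → E'}
    {y : E} (hj : ContDiffAt ℝ 2 j y) (hX : DifferentiableAt ℝ X y) (hY : DifferentiableAt ℝ Y y)
    (hX' : DifferentiableAt ℝ X' (j y)) (hY' : DifferentiableAt ℝ Y' (j y))
    (hXX' : ∀ᶠ z in nhds y, fderiv ℝ j z (X z) = X' (j z))
    (hYY' : ∀ᶠ z in nhds y, fderiv ℝ j z (Y z) = Y' (j z)) :
    fderiv ℝ j y (lieBracket ℝ X Y y) = lieBracket ℝ X' Y' (j y) := by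
  have hsymm : fderiv ℝ (fderiv ℝ j) y (X y) (Y y) = fderiv ℝ (fderiv ℝ j) y (Y y) (X y) :=
    (hj.isSymmSndFDerivAt (by simp)) _ _
  have hj1 : DifferentiableAt ℝ j y := hj.differentiableAt (by norm_num)
  have hj' : DifferentiableAt ℝ (fderiv ℝ j) y :=
    (hj.fderiv_right (m := 1) (by norm_num)).differentiableAt (by norm_num)
  have key : ∀ {Z : E → E} {Z' : E' → E'}, DifferentiableAt ℝ Z y → DifferentiableAt ℝ Z' (j y) →
      (∀ᶠ z in nhds y, fderiv ℝ j z (Z z) = Z' (j z)) → ∀ u,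
      fderiv ℝ Z' (j y) (fderiv ℝ j y u)
        = fderiv ℝ (fderiv ℝ j) y u (Z y) + fderiv ℝ j y (fderiv ℝ Z y u) := by
    intro Z Z' hZ hZ' h u
    have h1 := (hZ'.hasFDerivAt.comp y hj1.hasFDerivAt).fderiv
    have h2 := (hj'.hasFDerivAt.clm_apply hZ.hasFDerivAt).fderiv
    have h3 : (fun z => fderiv ℝ j z (Z z)) =ᶠ[nhds y] Z' ∘ j := h
    rw [← h3.fderiv_eq, h2] at h1
    have := congrArg (fun A => A u) h1
    simpa [add_comm] using this.symm
  rw [lieBracket, lieBracket, ← hXX'.self_of_nhds, ← hYY'.self_of_nhds, key hX hX' hXX',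
    key hY hY' hYY', map_sub, hsymm]
  abel

variable {n m : ℕ} {M : Type*} [TopologicalSpace M]
  [ChartedSpace (EuclideanSpace ℝ (Fin n)) M]

/-- The coordinate expression of a vector field in the preferred chart at `x`. -/
def chartField (X : (x : M) → TangentSpace (𝓡 n) x) (x : M) (q : EuclideanSpace ℝ (Fin n)) :
    EuclideanSpace ℝ (Fin n) :=
  mpullbackWithin 𝓘(ℝ, EuclideanSpace ℝ (Fin n)) (𝓡 n) (extChartAt (𝓡 n) x).symm X
    (range (𝓡 n)) q

/-- The differential of the preferred chart at `x`, as a map between model spaces. -/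
def chartDeriv (x p : M) : EuclideanSpace ℝ (Fin n) →L[ℝ] EuclideanSpace ℝ (Fin n) :=
  mfderiv (𝓡 n) 𝓘(ℝ, EuclideanSpace ℝ (Fin n)) (extChartAt (𝓡 n) x) p

lemma chartDeriv_mlieBracket (X Y : (x : M) → TangentSpace (𝓡 n) x) (x : M) :
    mlieBracket (𝓡 n) X Y x = (chartDeriv (n := n) x x).inverse
      (lieBracket ℝ (chartField X x) (chartField Y x) (extChartAt (𝓡 n) x x)) := by
  have hset : (extChartAt (𝓡 n) x).symm ⁻¹' univ ∩ range (𝓡 n) = univ := by simp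
  rw [← lieBracketWithin_univ, ← hset]
  rfl

variable [IsManifold (𝓡 n) ∞ M]

lemma chartField_apply (X : (x : M) → TangentSpace (𝓡 n) x) {x p : M}
    (hp : p ∈ (extChartAt (𝓡 n) x).source) :
    chartField X x (extChartAt (𝓡 n) x p) = chartDeriv x p (X p) := by
  have : IsManifold (𝓡 n) 1 M := IsManifold.of_le (n := ∞) (by norm_cast)
  let A : EuclideanSpace ℝ (Fin n) →L[ℝ] EuclideanSpace ℝ (Fin n) :=
    mfderivWithin 𝓘(ℝ, EuclideanSpace ℝ (Fin n)) (𝓡 n)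
        (extChartAt (𝓡 n) x).symm (range (𝓡 n)) (extChartAt (𝓡 n) x p)
  have h1 : (chartDeriv x p).comp A = ContinuousLinearMap.id ℝ _ :=
    mfderiv_extChartAt_comp_mfderivWithin_extChartAt_symm' (I := 𝓡 n) hp
  have h2 : A.comp (chartDeriv x p) = ContinuousLinearMap.id ℝ _ :=
    mfderivWithin_extChartAt_symm_comp_mfderiv_extChartAt' (I := 𝓡 n) hp
  have h3 : A.inverse = chartDeriv x p := ContinuousLinearMap.inverse_eq h2 h1
  have h4 : (X ((extChartAt (𝓡 n) x).symm (extChartAt (𝓡 n) x p)) : EuclideanSpace ℝ (Fin n))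
      = X p := congrArg (fun q => (X q : EuclideanSpace ℝ (Fin n)))
        ((extChartAt (𝓡 n) x).left_inv hp)
  change A.inverse (X ((extChartAt (𝓡 n) x).symm (extChartAt (𝓡 n) x p)) :
    EuclideanSpace ℝ (Fin n)) = _
  rw [h3]
  exact congrArg (chartDeriv x p) h4

lemma differentiableAt_chartField {X : (x : M) → TangentSpace (𝓡 n) x} {x : M}
    (hX : MDifferentiableAt (𝓡 n) (𝓡 n).tangent
      (fun x => (⟨x, X x⟩ : TangentBundle (𝓡 n) M)) x) :
    DifferentiableAt ℝ (chartField X x) (extChartAt (𝓡 n) x x) := by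
  have : IsManifold (𝓡 n) 2 M := IsManifold.of_le (n := ∞) (by norm_cast)
  have h : DifferentiableWithinAt ℝ (chartField X x) _ _ :=
    MDifferentiableWithinAt.differentiableWithinAt_mpullbackWithin_vectorField (s := univ)
      hX.mdifferentiableWithinAt
  exact h.differentiableAt (by simp)

/-- Brackets of related vector fields are related. -/
theorem mfderiv_lieBracket_of_related {ι : EuclideanSpace ℝ (Fin m) → M}
    {X Y : EuclideanSpace ℝ (Fin m) → EuclideanSpace ℝ (Fin m)}
    {X' Y' : (x : M) → TangentSpace (𝓡 n) x} {y : EuclideanSpace ℝ (Fin m)}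
    (hι : ContMDiffAt (𝓡 m) (𝓡 n) ∞ ι y) (hX : DifferentiableAt ℝ X y)
    (hY : DifferentiableAt ℝ Y y)
    (hX' : MDifferentiableAt (𝓡 n) (𝓡 n).tangent
      (fun x => (⟨x, X' x⟩ : TangentBundle (𝓡 n) M)) (ι y))
    (hY' : MDifferentiableAt (𝓡 n) (𝓡 n).tangent
      (fun x => (⟨x, Y' x⟩ : TangentBundle (𝓡 n) M)) (ι y))
    (hXX' : ∀ᶠ z in nhds y, mfderiv (𝓡 m) (𝓡 n) ι z (X z) = X' (ι z))
    (hYY' : ∀ᶠ z in nhds y, mfderiv (𝓡 m) (𝓡 n) ι z (Y z) = Y' (ι z)) :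
    mfderiv (𝓡 m) (𝓡 n) ι y (lieBracket (E := EuclideanSpace ℝ (Fin m)) ℝ X Y y)
      = mlieBracket (𝓡 n) X' Y' (ι y) := by
  have i1 : IsManifold (𝓡 n) 1 M := IsManifold.of_le (n := ∞) (by norm_cast)
  set ψ := extChartAt (𝓡 n) (ι y) with hψ
  have hinv : (chartDeriv (n := n) (ι y) (ι y)).IsInvertible :=
    isInvertible_mfderiv_extChartAt (mem_extChartAt_source _)
  have hιev : ∀ᶠ z in nhds y, MDifferentiableAt (𝓡 m) (𝓡 n) ι z := by
    have h1 : ContMDiffAt (𝓡 m) (𝓡 n) 1 ι y := hι.of_le (by norm_cast)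
    filter_upwards [(contMDiffAt_iff_contMDiffAt_nhds (by simp)).1 h1] with z hz using
      hz.mdifferentiableAt (by simp)
  have hsrc : ∀ᶠ z in nhds y, ι z ∈ ψ.source :=
    hι.continuousAt.eventually (extChartAt_source_mem_nhds _)
  -- Composing `ι` with the chart at `ι y` reduces the claim to the vector space version.
  have hder : ∀ᶠ z in nhds y, ∀ u, fderiv ℝ (ψ ∘ ι) z u
      = chartDeriv (ι y) (ι z) (mfderiv (𝓡 m) (𝓡 n) ι z u) := by
    filter_upwards [hιev, hsrc] with z hz hzs u
    have hψz : MDifferentiableAt (𝓡 n) 𝓘(ℝ, EuclideanSpace ℝ (Fin n)) ψ (ι z) :=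
      mdifferentiableAt_extChartAt (by rwa [← extChartAt_source (𝓡 n)])
    have := mfderiv_comp z hψz hz
    rw [← mfderiv_eq_fderiv, this]
    rfl
  have hj : ContDiffAt ℝ 2 (ψ ∘ ι) y := by
    rw [← contMDiffAt_iff_contDiffAt]
    exact (contMDiffAt_extChartAt (n := 2)).comp y (hι.of_le (by norm_cast))
  have hpull : ∀ {Z : EuclideanSpace ℝ (Fin m) → EuclideanSpace ℝ (Fin m)}
      {Z' : (x : M) → TangentSpace (𝓡 n) x},
      (∀ᶠ z in nhds y, mfderiv (𝓡 m) (𝓡 n) ι z (Z z) = Z' (ι z)) → ∀ᶠ z in nhds y,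
      fderiv ℝ (ψ ∘ ι) z (Z z) = chartField Z' (ι y) ((ψ ∘ ι) z) := by
    intro Z Z' h
    filter_upwards [h, hsrc, hder] with z hz hzs hd
    rw [hd, hz, Function.comp_apply, chartField_apply Z' hzs]
  have key := fderiv_lieBracket_of_related hj hX hY (differentiableAt_chartField hX')
    (differentiableAt_chartField hY') (hpull hXX') (hpull hYY')
  rw [hder.self_of_nhds] at key
  rw [chartDeriv_mlieBracket]
  change _ = (chartDeriv (n := n) (ι y) (ι y)).inverse (lieBracket ℝ (chartField X' (ι y))
    (chartField Y' (ι y)) ((ψ ∘ ι) y))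
  rw [← key]
  obtain ⟨A, hA⟩ := hinv
  rw [← hA, ContinuousLinearMap.inverse_equiv]
  exact (A.symm_apply_apply _).symm

end RelatedFields

/-! ### Scalar curvature of parametrized submanifolds -/

section PulledBackFrame

open VectorField Set Bundle

variable {n m : ℕ} {M : Type*} [TopologicalSpace M]
  [ChartedSpace (EuclideanSpace ℝ (Fin n)) M] [IsManifold (𝓡 n) ∞ M]

/-- The structure coefficients `g([eₐ, e_b], e_d)` of a frame. -/
def structCoeff (g : SmoothMetric n M) {κ : Type*} (e : κ → (x : M) → TangentSpace (𝓡 n) x)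
    (a b d : κ) (x : M) : ℝ :=
  g.inner x (mlieBracket (𝓡 n) (e a) (e b) x) (e d x)

/-- The derivative of a real function along a tangent vector. -/
def dirDeriv (f : M → ℝ) (x : M) (v : TangentSpace (𝓡 n) x) : ℝ :=
  mfderiv (𝓡 n) 𝓘(ℝ, ℝ) f x v

/-- The scalar curvature of the distribution spanned by a family `e` of orthonormal vector fields
closed under brackets, computed from its structure coefficients. -/
def frameScalar (g : SmoothMetric n M) {κ : Type*} [Fintype κ]
    (e : κ → (x : M) → TangentSpace (𝓡 n) x) (x : M) : ℝ :=
  ∑ a, (2 * dirDeriv (fun z => ∑ b, structCoeff g e a b b z) x (e a x)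
      - (∑ b, structCoeff g e a b b x) ^ 2)
    + structQuadratic fun a b d => structCoeff g e a b d x

lemma metricForm_pullbackGram (g : SmoothMetric n M) (ι : EuclideanSpace ℝ (Fin m) → M)
    (y u v : EuclideanSpace ℝ (Fin m)) :
    metricForm (pullbackGram g ι) y u v
      = g.inner (ι y) (mfderiv (𝓡 m) (𝓡 n) ι y u) (mfderiv (𝓡 m) (𝓡 n) ι y v) := by
  let D : EuclideanSpace ℝ (Fin m) →L[ℝ] TangentSpace (𝓡 n) (ι y) := mfderiv (𝓡 m) (𝓡 n) ι y
  change _ = g.inner (ι y) (D u) (D v)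
  conv_rhs => rw [eq_sum_single u, eq_sum_single v]
  have h : ∀ i j, pullbackGram g ι y i j = g.inner (ι y) (D (EuclideanSpace.single i 1))
    (D (EuclideanSpace.single j 1)) := fun i j => rfl
  simp only [metricForm_apply, h, map_sum, map_smul, FunLike.coe_sum, Finset.sum_apply,
    FunLike.coe_smul, Pi.smul_apply, smul_eq_mul, Finset.mul_sum]
  rw [Finset.sum_comm]
  exact Finset.sum_congr rfl fun i _ => Finset.sum_congr rfl fun j _ => by ring

lemma contMDiffWithinAt_metric_apply (g : SmoothMetric n M) {E H N : Type*}
    [NormedAddCommGroup E] [NormedSpace ℝ E] [TopologicalSpace H] {I : ModelWithCorners ℝ E H}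
    [TopologicalSpace N] [ChartedSpace H N] {b : N → M} {v w : (y : N) → TangentSpace (𝓡 n) (b y)}
    {s : Set N} {y : N}
    (hv : ContMDiffWithinAt I (𝓡 n).tangent ∞ (fun y => (⟨b y, v y⟩ : TangentBundle (𝓡 n) M)) s y)
    (hw : ContMDiffWithinAt I (𝓡 n).tangent ∞
      (fun y => (⟨b y, w y⟩ : TangentBundle (𝓡 n) M)) s y) :
    ContMDiffWithinAt I 𝓘(ℝ, ℝ) ∞ (fun y => g.inner (b y) (v y) (w y)) s y := by
  have hb : ContMDiffWithinAt I (𝓡 n) ∞ b s y := ((contMDiffWithinAt_totalSpace).1 hv).1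
  have : ContMDiffWithinAt I ((𝓡 n).prod 𝓘(ℝ)) ∞
      (fun y => TotalSpace.mk' ℝ (E := Bundle.Trivial M ℝ) (b y) (g.inner (b y) (v y) (w y)))
      s y := by
    apply ContMDiffWithinAt.clm_bundle_apply₂ (F₁ := EuclideanSpace ℝ (Fin n))
      (F₂ := EuclideanSpace ℝ (Fin n))
    · exact ContMDiffAt.comp_contMDiffWithinAt y g.contMDiff.contMDiffAt hb
    · exact hv
    · exact hw
  simp only [contMDiffWithinAt_totalSpace] at this
  exact this.2

lemma contMDiffOn_mfderiv_const {ι : EuclideanSpace ℝ (Fin m) → M}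
    {V : Set (EuclideanSpace ℝ (Fin m))} (hV : IsOpen V) (hι : ContMDiffOn (𝓡 m) (𝓡 n) ∞ ι V)
    (u : EuclideanSpace ℝ (Fin m)) :
    ContMDiffOn (𝓡 m) (𝓡 n).tangent ∞
      (fun y => (⟨ι y, mfderiv (𝓡 m) (𝓡 n) ι y u⟩ : TangentBundle (𝓡 n) M)) V := by
  have h1 : ContMDiffOn (𝓡 m).tangent (𝓡 n).tangent ∞ (tangentMapWithin (𝓡 m) (𝓡 n) ι V)
      (Bundle.TotalSpace.proj ⁻¹' V) := by
    have : IsManifold (𝓡 n) 1 M := IsManifold.of_le (n := ∞) (by norm_cast)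
    exact hι.contMDiffOn_tangentMapWithin (by simp) hV.uniqueMDiffOn
  have h2 : ContMDiffOn (𝓡 m) (𝓡 m).tangent ∞
      (fun y => (⟨y, u⟩ : TangentBundle (𝓡 m) (EuclideanSpace ℝ (Fin m)))) V := by
    exact contMDiffOn_vectorSpace_iff_contDiffOn.2 contDiffOn_const
  refine (h1.comp h2 fun y hy => hy).congr fun y hy => ?_
  simp only [Function.comp_apply, tangentMapWithin]
  rw [mfderivWithin_of_isOpen hV hy]

lemma contMDiffOn_structCoeff (g : SmoothMetric n M) {κ : Type*}
    {e : κ → (x : M) → TangentSpace (𝓡 n) x} {U : Set M} (hU : IsOpen U)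
    (he : ∀ i, ContMDiffOn (𝓡 n) (𝓡 n).tangent ∞
      (fun x => (⟨x, e i x⟩ : TangentBundle (𝓡 n) M)) U) (a b d : κ) :
    ContMDiffOn (𝓡 n) 𝓘(ℝ, ℝ) ∞ (structCoeff g e a b d) U := by
  intro x hx
  have : IsManifold (𝓡 n) (((⊤ : ℕ∞) : WithTop ℕ∞) + 1) M := by
    simpa using (inferInstance : IsManifold (𝓡 n) ∞ M)
  have hb : ContMDiffAt (𝓡 n) (𝓡 n).tangent ∞
      (fun x => (⟨x, mlieBracket (𝓡 n) (e a) (e b) x⟩ : TangentBundle (𝓡 n) M)) x :=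
    haveI : IsManifold (𝓡 n) (minSmoothness ℝ 2) M := by
      simpa using IsManifold.of_le (m := 2) (n := ∞) (I := 𝓡 n) (M := M) (by norm_cast)
    ContMDiffAt.mlieBracket_vectorField (n := ⊤) (m := ⊤) ((he a).contMDiffAt (hU.mem_nhds hx))
      ((he b).contMDiffAt (hU.mem_nhds hx)) (by simp)
  exact contMDiffWithinAt_metric_apply g hb.contMDiffWithinAt (he d x hx)

/-- The vector fields on `ℝᵐ` related by `ι` to the members of an orthonormal family. -/
def pullFrame (g : SmoothMetric n M) (ι : EuclideanSpace ℝ (Fin m) → M)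
    (e : Fin m → (x : M) → TangentSpace (𝓡 n) x) (a : Fin m) (y : EuclideanSpace ℝ (Fin m)) :
    EuclideanSpace ℝ (Fin m) :=
  ∑ k, (∑ l, (pullbackGram g ι y)⁻¹ k l *
    g.inner (ι y) (mfderiv (𝓡 m) (𝓡 n) ι y (EuclideanSpace.single l (1 : ℝ))) (e a (ι y))) •
      EuclideanSpace.single k (1 : ℝ)

lemma pullbackGram_isSymm (g : SmoothMetric n M) (ι : EuclideanSpace ℝ (Fin m) → M)
    (y : EuclideanSpace ℝ (Fin m)) : (pullbackGram g ι y).IsSymm :=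
  Matrix.IsSymm.ext fun _ _ => g.symm _ _ _

variable {g : SmoothMetric n M} {ι : EuclideanSpace ℝ (Fin m) → M}
  {e : Fin m → (x : M) → TangentSpace (𝓡 n) x}

lemma exists_pullback_orthonormal {y : EuclideanSpace ℝ (Fin m)}
    (horth : ∀ i j, g.inner (ι y) (e i (ι y)) (e j (ι y)) = if i = j then 1 else 0)
    (hrange : ∀ a, e a (ι y) ∈ LinearMap.range (mfderiv (𝓡 m) (𝓡 n) ι y).toLinearMap) :
    ∃ w : Fin m → EuclideanSpace ℝ (Fin m),
      (∀ a, mfderiv (𝓡 m) (𝓡 n) ι y (w a) = e a (ι y)) ∧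
      ∀ a b, metricForm (pullbackGram g ι) y (w a) (w b) = if a = b then 1 else 0 := by
  choose w hw using hrange
  change Fin m → EuclideanSpace ℝ (Fin m) at w
  have hw' : ∀ a, mfderiv (𝓡 m) (𝓡 n) ι y (w a) = e a (ι y) := hw
  refine ⟨w, hw', fun a b => ?_⟩
  rw [metricForm_pullbackGram, hw', hw', horth]

lemma isUnit_det_pullbackGram {y : EuclideanSpace ℝ (Fin m)}
    (horth : ∀ i j, g.inner (ι y) (e i (ι y)) (e j (ι y)) = if i = j then 1 else 0)
    (hrange : ∀ a, e a (ι y) ∈ LinearMap.range (mfderiv (𝓡 m) (𝓡 n) ι y).toLinearMap) :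
    IsUnit (pullbackGram g ι y).det := by
  obtain ⟨w, -, hw⟩ := exists_pullback_orthonormal horth hrange
  exact Matrix.isUnit_det_of_left_inverse (frameMatrix_mul_transpose_mul hw)

/-- If `w` is a preimage of `e_a`, then pairing `e_a` with the coordinate vectors gives the Gram
matrix times `w`. The formula for `pullFrame` inverts this and so returns `w`, while being visibly
smooth in the base point. -/
lemma mfderiv_pullFrame {y : EuclideanSpace ℝ (Fin m)}
    (horth : ∀ i j, g.inner (ι y) (e i (ι y)) (e j (ι y)) = if i = j then 1 else 0)
    (hrange : ∀ a, e a (ι y) ∈ LinearMap.range (mfderiv (𝓡 m) (𝓡 n) ι y).toLinearMap)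
    (a : Fin m) : mfderiv (𝓡 m) (𝓡 n) ι y (pullFrame g ι e a y) = e a (ι y) := by
  obtain ⟨w, hwe, hw⟩ := exists_pullback_orthonormal horth hrange
  have : pullFrame g ι e a y = w a := by
    have hpair : ∀ l, g.inner (ι y) (mfderiv (𝓡 m) (𝓡 n) ι y (EuclideanSpace.single l (1 : ℝ)))
        (e a (ι y)) = ∑ j, pullbackGram g ι y l j * w a j := by
      intro l
      rw [← hwe, ← metricForm_pullbackGram, metricForm_apply]
      simp
    have hmul := Matrix.nonsing_inv_mul _ (isUnit_det_pullbackGram horth hrange)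
    rw [pullFrame]
    conv_rhs => rw [eq_sum_single (w a)]
    refine Finset.sum_congr rfl fun k _ => ?_
    congr 1
    simp_rw [hpair]
    have := congrArg (fun A => A.mulVec (w a).ofLp k) hmul
    simp only [← Matrix.mulVec_mulVec, Matrix.one_mulVec] at this
    simpa [Matrix.mulVec, dotProduct] using this
  rw [this, hwe]

/-- By Cramer's rule the entries are polynomials in the entries of `A` divided by the determinant.
-/
lemma contDiffOn_matrix_inv {E : Type*} [NormedAddCommGroup E] [NormedSpace ℝ E]
    {A : E → Matrix (Fin m) (Fin m) ℝ} {V : Set E}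
    (hA : ∀ i j, ContDiffOn ℝ ∞ (fun z => A z i j) V) (hdet : ∀ z ∈ V, IsUnit (A z).det)
    (i j : Fin m) : ContDiffOn ℝ ∞ (fun z => (A z)⁻¹ i j) V := by
  have hd : ∀ {B : E → Matrix (Fin m) (Fin m) ℝ}, (∀ i j, ContDiffOn ℝ ∞ (fun z => B z i j) V) →
      ContDiffOn ℝ ∞ (fun z => (B z).det) V := by
    intro B hB
    simp_rw [Matrix.det_apply]
    exact ContDiffOn.sum fun σ _ => (contDiffOn_prod fun k _ => hB _ _).const_smul _
  have hadj : ContDiffOn ℝ ∞ (fun z => (A z).adjugate i j) V := by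
    simp_rw [Matrix.adjugate_apply]
    refine hd fun k l => ?_
    simp only [Matrix.updateRow_apply]
    split_ifs
    · exact contDiffOn_const
    · exact hA k l
  refine (((hd hA).inv fun z hz => (hdet z hz).ne_zero).mul hadj).congr fun z hz => ?_
  simp [Matrix.inv_def]

variable {V : Set (EuclideanSpace ℝ (Fin m))} {U : Set M}

lemma contDiffOn_pullbackGram (hV : IsOpen V) (hι : ContMDiffOn (𝓡 m) (𝓡 n) ∞ ι V)
    (i j : Fin m) : ContDiffOn ℝ ∞ (fun z => pullbackGram g ι z i j) V := by
  rw [← contMDiffOn_iff_contDiffOn]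
  exact fun y hy => contMDiffWithinAt_metric_apply g (contMDiffOn_mfderiv_const hV hι _ y hy)
    (contMDiffOn_mfderiv_const hV hι _ y hy)

lemma contDiffOn_pullFrame (hV : IsOpen V) (hι : ContMDiffOn (𝓡 m) (𝓡 n) ∞ ι V)
    (he : ∀ i, ContMDiffOn (𝓡 n) (𝓡 n).tangent ∞
      (fun x => (⟨x, e i x⟩ : TangentBundle (𝓡 n) M)) U) (hmaps : MapsTo ι V U)
    (horth : ∀ x ∈ U, ∀ i j, g.inner x (e i x) (e j x) = if i = j then 1 else 0)
    (hrange : ∀ y ∈ V, ∀ a,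
      e a (ι y) ∈ LinearMap.range (mfderiv (𝓡 m) (𝓡 n) ι y).toLinearMap) (a : Fin m) :
    ContDiffOn ℝ ∞ (pullFrame g ι e a) V := by
  unfold pullFrame
  refine ContDiffOn.sum fun k _ => contDiffOn_smul_const (ContDiffOn.sum fun l _ =>
    (contDiffOn_matrix_inv (contDiffOn_pullbackGram hV hι) (fun z hz =>
      isUnit_det_pullbackGram (horth _ (hmaps hz)) (hrange z hz)) k l).mul ?_) _
  rw [← contMDiffOn_iff_contDiffOn]
  exact fun y hy => contMDiffWithinAt_metric_apply g (contMDiffOn_mfderiv_const hV hι _ y hy)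
    (((he a).comp hι hmaps) y hy)

lemma mfderiv_lieBracket_pullFrame (hU : IsOpen U) (hV : IsOpen V)
    (hι : ContMDiffOn (𝓡 m) (𝓡 n) ∞ ι V)
    (he : ∀ i, ContMDiffOn (𝓡 n) (𝓡 n).tangent ∞
      (fun x => (⟨x, e i x⟩ : TangentBundle (𝓡 n) M)) U) (hmaps : MapsTo ι V U)
    (horth : ∀ x ∈ U, ∀ i j, g.inner x (e i x) (e j x) = if i = j then 1 else 0)
    (hrange : ∀ y ∈ V, ∀ a,
      e a (ι y) ∈ LinearMap.range (mfderiv (𝓡 m) (𝓡 n) ι y).toLinearMap)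
    {y : EuclideanSpace ℝ (Fin m)} (hy : y ∈ V) (a b : Fin m) :
    mfderiv (𝓡 m) (𝓡 n) ι y
      (lieBracket (E := EuclideanSpace ℝ (Fin m)) ℝ (pullFrame g ι e a) (pullFrame g ι e b) y)
      = mlieBracket (𝓡 n) (e a) (e b) (ι y) := by
  have hd : ∀ a, DifferentiableAt ℝ (pullFrame g ι e a) y := fun a =>
    ((contDiffOn_pullFrame hV hι he hmaps horth hrange a).contDiffAt
      (hV.mem_nhds hy)).differentiableAt (by simp)
  have hm : ∀ a, MDifferentiableAt (𝓡 n) (𝓡 n).tangent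
      (fun x => (⟨x, e a x⟩ : TangentBundle (𝓡 n) M)) (ι y) := fun a =>
    ((he a).contMDiffAt (hU.mem_nhds (hmaps hy))).mdifferentiableAt (by simp)
  have hr : ∀ a, ∀ᶠ z in nhds y,
      mfderiv (𝓡 m) (𝓡 n) ι z (pullFrame g ι e a z) = e a (ι z) := fun a => by
    filter_upwards [hV.mem_nhds hy] with z hz using
      mfderiv_pullFrame (horth _ (hmaps hz)) (hrange z hz) a
  exact mfderiv_lieBracket_of_related (hι.contMDiffAt (hV.mem_nhds hy)) (hd a) (hd b) (hm a)
    (hm b) (hr a) (hr b)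

/-- The scalar curvature of a parametrized submanifold in terms of an orthonormal family of vector
fields tangent to it. -/
theorem coordScalar_pullbackGram (hU : IsOpen U) (hV : IsOpen V)
    (hι : ContMDiffOn (𝓡 m) (𝓡 n) ∞ ι V)
    (he : ∀ i, ContMDiffOn (𝓡 n) (𝓡 n).tangent ∞
      (fun x => (⟨x, e i x⟩ : TangentBundle (𝓡 n) M)) U) (hmaps : MapsTo ι V U)
    (horth : ∀ x ∈ U, ∀ i j, g.inner x (e i x) (e j x) = if i = j then 1 else 0)
    (hrange : ∀ y ∈ V, ∀ a,
      e a (ι y) ∈ LinearMap.range (mfderiv (𝓡 m) (𝓡 n) ι y).toLinearMap)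
    {y : EuclideanSpace ℝ (Fin m)} (hy : y ∈ V) :
    coordScalar (pullbackGram g ι) y = frameScalar g e (ι y) := by
  have hpf : ∀ z ∈ V, ∀ a, mfderiv (𝓡 m) (𝓡 n) ι z (pullFrame g ι e a z) = e a (ι z) :=
    fun z hz => mfderiv_pullFrame (horth _ (hmaps hz)) (hrange z hz)
  have hc : ∀ z ∈ V, ∀ a b d, metricForm (pullbackGram g ι) z
      (lieBracket ℝ (pullFrame g ι e a) (pullFrame g ι e b) z) (pullFrame g ι e d z)
      = structCoeff g e a b d (ι z) := by
    intro z hz a b d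
    rw [metricForm_pullbackGram, hpf z hz]
    exact congrArg (fun v => g.inner (ι z) v (e d (ι z)))
      (mfderiv_lieBracket_pullFrame hU hV hι he hmaps horth hrange hz a b)
  rw [coordScalar_eq_of_frame hV (contDiffOn_pullbackGram hV hι)
    (fun z _ => pullbackGram_isSymm g ι z) (contDiffOn_pullFrame hV hι he hmaps horth hrange)
    (fun z hz a b => by rw [metricForm_pullbackGram, hpf z hz, hpf z hz, horth _ (hmaps hz)]) hy,
    frameScalar]
  simp_rw [hc y hy]
  congr 1
  refine Finset.sum_congr rfl fun a _ => ?_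
  congr 2
  -- The trace of the structure coefficients upstairs is the pullback of the one on `M`. The chain
  -- rule then turns its derivative along the pulled-back frame into the derivative along `e a`.
  have hev : (fun z => ∑ b, metricForm (pullbackGram g ι) z
      (lieBracket ℝ (pullFrame g ι e a) (pullFrame g ι e b) z) (pullFrame g ι e b z))
      =ᶠ[nhds y] (fun x => ∑ b, structCoeff g e a b b x) ∘ ι := by
    filter_upwards [hV.mem_nhds hy] with z hz
    simp [hc z hz]
  have hH : MDifferentiableAt (𝓡 n) 𝓘(ℝ, ℝ) (fun x => ∑ b, structCoeff g e a b b x) (ι y) := by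
    have : ContMDiffOn (𝓡 n) 𝓘(ℝ, ℝ) ∞ (fun x => ∑ b, structCoeff g e a b b x) U :=
      contMDiffOn_finsetSum fun b _ => contMDiffOn_structCoeff g hU he a b b
    exact (this.contMDiffAt (hU.mem_nhds (hmaps hy))).mdifferentiableAt (by simp)
  have hιd : MDifferentiableAt (𝓡 m) (𝓡 n) ι y :=
    (hι.contMDiffAt (hV.mem_nhds hy)).mdifferentiableAt (by simp)
  rw [hev.fderiv_eq, ← mfderiv_eq_fderiv, mfderiv_comp y hH hιd, dirDeriv, ← hpf y hy a]
  rfl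

end PulledBackFrame

/-! ### Local parametrizations of leaves -/

section LeafParametrization

open Set

variable {r s : ℕ} {M : Type*} [TopologicalSpace M]
  [ChartedSpace (EuclideanSpace ℝ (Fin (r + s))) M]

/-- The inclusion of `ℝˢ` into `ℝʳ⁺ˢ` as the last `s` coordinates. -/
def leafInclusion (r s : ℕ) : EuclideanSpace ℝ (Fin s) →L[ℝ] EuclideanSpace ℝ (Fin (r + s)) :=
  ∑ α, (EuclideanSpace.proj α : EuclideanSpace ℝ (Fin s) →L[ℝ] ℝ).smulRight
    (EuclideanSpace.single (Fin.natAdd r α) (1 : ℝ))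

lemma leafInclusion_castAdd (u : EuclideanSpace ℝ (Fin s)) (i : Fin r) :
    leafInclusion r s u (Fin.castAdd s i) = 0 := by
  have h : ∀ α : Fin s, Fin.castAdd s i ≠ Fin.natAdd r α := fun α h => by
    have := congrArg Fin.val h
    simp at this
    omega
  simp [leafInclusion, h]

lemma leafInclusion_natAdd (u : EuclideanSpace ℝ (Fin s)) (α : Fin s) :
    leafInclusion r s u (Fin.natAdd r α) = u α := by
  simp [leafInclusion, Pi.single_apply]

lemma mem_range_leafInclusion (w : EuclideanSpace ℝ (Fin (r + s))) :
    (∃ u, leafInclusion r s u = w) ↔ ∀ i : Fin r, w (Fin.castAdd s i) = 0 := by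
  constructor
  · rintro ⟨u, rfl⟩ i
    exact leafInclusion_castAdd u i
  · intro h
    refine ⟨WithLp.toLp 2 fun α => w (Fin.natAdd r α), ?_⟩
    ext i
    refine Fin.addCases (fun i => ?_) (fun α => ?_) i
    · rw [leafInclusion_castAdd, h]
    · rw [leafInclusion_natAdd]

/-- There are local parametrizations of leaves through every point. -/
theorem exists_isLeafParametrization (F : Foliation r s M) (x : M) :
    ∃ V ι, IsLeafParametrization F V ι ∧ 0 ∈ V ∧ ι 0 = x := by
  obtain ⟨φ, hφ, hx, hY⟩ := F.exists_foliated_chart x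
  -- The affine slice through `φ x` in the last `s` coordinate directions; its image under `φ.symm`
  -- is a plaque.
  set j : EuclideanSpace ℝ (Fin s) → EuclideanSpace ℝ (Fin (r + s)) :=
    fun t => φ x + leafInclusion r s t with hj
  have hjd : ContDiff ℝ ∞ j := contDiff_const.add (leafInclusion r s).contDiff
  have hs1 := contMDiffOn_of_mem_maximalAtlas hφ
  have hs2 := contMDiffOn_symm_of_mem_maximalAtlas hφ
  have hφd : φ.MDifferentiable (𝓡 (r + s)) (𝓡 (r + s)) :=
    ⟨hs1.mdifferentiableOn (by simp), hs2.mdifferentiableOn (by simp)⟩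
  refine ⟨j ⁻¹' φ.target, φ.symm ∘ j, ⟨φ.open_target.preimage hjd.continuous, ?_, ?_⟩, ?_, ?_⟩
  · exact hs2.comp hjd.contMDiff.contMDiffOn (fun t ht => ht)
  · intro t ht
    have ht' : j t ∈ φ.target := ht
    have hsrc : φ.symm (j t) ∈ φ.source := φ.map_target ht'
    have hjm : HasMFDerivAt (𝓡 s) (𝓡 (r + s)) j t (leafInclusion r s) :=
      ((leafInclusion r s).hasFDerivAt.const_add (φ x)).hasMFDerivAt
    have hder : ∀ u, mfderiv (𝓡 s) (𝓡 (r + s)) (φ.symm ∘ j) t u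
        = mfderiv (𝓡 (r + s)) (𝓡 (r + s)) φ.symm (j t) (leafInclusion r s u) := by
      intro u
      rw [(((hφd.symm.mdifferentiableAt ht').hasMFDerivAt).comp t hjm).mfderiv]
      rfl
    have h1 := hφd.comp_symm_deriv ht'
    have h2 := hφd.symm_comp_deriv hsrc
    rw [φ.right_inv ht'] at h2
    ext v
    rw [Function.comp_apply, hY _ hsrc]
    refine Iff.trans ?_ (mem_range_leafInclusion (r := r) (s := s)
      (mfderiv (𝓡 (r + s)) (𝓡 (r + s)) φ (φ.symm (j t)) v))
    constructor
    · rintro ⟨u, hu⟩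
      refine ⟨u, ?_⟩
      rw [← (show mfderiv (𝓡 s) (𝓡 (r + s)) (φ.symm ∘ j) t u = v from hu), hder]
      exact (congrArg (fun A => A (leafInclusion r s u)) h1).symm
    · rintro ⟨u, hu⟩
      refine ⟨u, (hder u).trans ?_⟩
      rw [hu]
      exact congrArg (fun A => A v) h2
  · simpa [hj] using φ.map_source hx
  · simp [hj, φ.left_inv hx]

end LeafParametrization

/-! ### Smoothness of the square of a dual form -/

section SquareForm

open Bundle

variable {n : ℕ} {M : Type*} [TopologicalSpace M]
  [ChartedSpace (EuclideanSpace ℝ (Fin n)) M] [IsManifold (𝓡 n) ∞ M]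

lemma contDiff_smulRight {E F G : Type*} [NormedAddCommGroup E] [NormedSpace ℝ E]
    [NormedAddCommGroup F] [NormedSpace ℝ F] [NormedAddCommGroup G] [NormedSpace ℝ G]
    {f : G → E →L[ℝ] ℝ} {h : G → F} (hf : ContDiff ℝ ∞ f) (hh : ContDiff ℝ ∞ h) :
    ContDiff ℝ ∞ fun z => (f z).smulRight (h z) :=
  (isBoundedBilinearMap_smulRight (𝕜 := ℝ) (E := E) (F := F)).contDiff.comp (hf.prodMk hh)

/-- The square of the linear form dual to `v`. -/
def dualSquare (g : SmoothMetric n M) (x : M) (v : TangentSpace (𝓡 n) x) :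
    TangentSpace (𝓡 n) x →L[ℝ] TangentSpace (𝓡 n) x →L[ℝ] ℝ :=
  (g.inner x v).smulRight (g.inner x v)

lemma dualSquare_apply (g : SmoothMetric n M) (x : M) (v u w : TangentSpace (𝓡 n) x) :
    dualSquare g x v u w = g.inner x v u * g.inner x v w := rfl

/-- In local trivializations the section is the composite of the smooth coordinate expression of
`g(v, ·)` with the smooth map `A ↦ A ⊗ A`. Most of the work is identifying the two coordinate
expressions near `x₀`. -/
lemma contMDiffAt_dualSquare (g : SmoothMetric n M) {v : (x : M) → TangentSpace (𝓡 n) x} {x₀ : M}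
    (hv : ContMDiffAt (𝓡 n) (𝓡 n).tangent ∞
      (fun x => (⟨x, v x⟩ : TangentBundle (𝓡 n) M)) x₀) :
    ContMDiffAt (𝓡 n) ((𝓡 n).prod
        𝓘(ℝ, EuclideanSpace ℝ (Fin n) →L[ℝ] EuclideanSpace ℝ (Fin n) →L[ℝ] ℝ)) ∞
      (fun x => TotalSpace.mk' (EuclideanSpace ℝ (Fin n) →L[ℝ] EuclideanSpace ℝ (Fin n) →L[ℝ] ℝ)
        (E := fun x : M => TangentSpace (𝓡 n) x →L[ℝ] TangentSpace (𝓡 n) x →L[ℝ] ℝ)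
        x (dualSquare g x (v x))) x₀ := by
  have h1 : ContMDiffAt (𝓡 n) ((𝓡 n).prod 𝓘(ℝ, EuclideanSpace ℝ (Fin n) →L[ℝ] ℝ)) ∞
      (fun x => TotalSpace.mk' (EuclideanSpace ℝ (Fin n) →L[ℝ] ℝ)
        (E := fun x : M => TangentSpace (𝓡 n) x →L[ℝ] Bundle.Trivial M ℝ x)
        x (g.inner x (v x))) x₀ := by
    apply ContMDiffAt.clm_bundle_apply (F₁ := EuclideanSpace ℝ (Fin n))
    · exact g.contMDiff.contMDiffAt
    · exact hv
  rw [contMDiffAt_hom_bundle] at h1 ⊢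
  refine ⟨contMDiffAt_id, ?_⟩
  have h2 := h1.2
  have hsm : ContDiff ℝ ∞ fun A : EuclideanSpace ℝ (Fin n) →L[ℝ] ℝ => A.smulRight A :=
    contDiff_smulRight contDiff_id contDiff_id
  have h3 := hsm.contMDiff.contMDiffAt.comp x₀ h2
  refine h3.congr_of_eventuallyEq ?_
  filter_upwards [(trivializationAt (EuclideanSpace ℝ (Fin n))
    (fun x : M => TangentSpace (𝓡 n) x) x₀).open_baseSet.mem_nhds
      (mem_baseSet_trivializationAt _ _ x₀)] with x hx
  ext u w
  have hb : x ∈ (trivializationAt (EuclideanSpace ℝ (Fin n) →L[ℝ] ℝ)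
      (fun b : M => TangentSpace (𝓡 n) b →L[ℝ] Bundle.Trivial M ℝ b) x₀).baseSet := by
    rw [hom_trivializationAt_baseSet]
    exact ⟨hx, Set.mem_univ _⟩
  have hlin : ∀ A : TangentSpace (𝓡 n) x →L[ℝ] Bundle.Trivial M ℝ x,
      Trivialization.linearMapAt ℝ (trivializationAt (EuclideanSpace ℝ (Fin n) →L[ℝ] ℝ)
        (fun b : M => TangentSpace (𝓡 n) b →L[ℝ] Bundle.Trivial M ℝ b) x₀) x A w
      = A ((trivializationAt (EuclideanSpace ℝ (Fin n)) (TangentSpace (𝓡 n)) x₀).symmL ℝ x w) := by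
    intro A
    rw [Trivialization.coe_linearMapAt_of_mem _ hb]
    change ContinuousLinearMap.inCoordinates (EuclideanSpace ℝ (Fin n)) (TangentSpace (𝓡 n)) ℝ
      (Trivial M ℝ) x₀ x x₀ x A w = _
    simp [ContinuousLinearMap.inCoordinates]
  have htriv : ∀ c : ℝ, (trivializationAt ℝ (Trivial M ℝ) x₀).continuousLinearMapAt ℝ x c = c := by
    intro c
    simp
  simp only [ContinuousLinearMap.inCoordinates, dualSquare, Function.comp_apply,
    ContinuousLinearMap.coe_comp, ContinuousLinearMap.smulRight_apply, map_smul,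
    FunLike.coe_smul, Pi.smul_apply, smul_eq_mul]
  exact congrArg₂ (· * ·) (htriv _).symm ((hlin (g.inner x (v x))).trans (htriv _).symm)

end SquareForm

/-! ### Construction of the collapsed metrics -/

section Collapse

open Bundle

variable {r s : ℕ} {M : Type*} [TopologicalSpace M]
  [ChartedSpace (EuclideanSpace ℝ (Fin (r + s))) M] [IsManifold (𝓡 (r + s)) ∞ M]
  {g : SmoothMetric (r + s) M} {F : Foliation r s M} {U U' : Set M}
  {e e' : Fin (r + s) → (x : M) → TangentSpace (𝓡 (r + s)) x} {x : M}

lemma IsAdaptedFrameOn.mem_tangent (h : IsAdaptedFrameOn g F U e) (hx : x ∈ U) (α : Fin s) :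
    e (Fin.natAdd r α) x ∈ F.tangent x := by
  rw [← h.span_eq x hx]
  exact Submodule.subset_span ⟨α, rfl⟩

lemma IsAdaptedFrameOn.isOrthogonalTo (h : IsAdaptedFrameOn g F U e) (hx : x ∈ U) (j : Fin r) :
    IsOrthogonalTo g (e (Fin.castAdd s j) x) (F.tangent x) := by
  intro u hu
  rw [← h.span_eq x hx, Submodule.mem_span_range_iff_exists_fun] at hu
  obtain ⟨c, rfl⟩ := hu
  have hne : ∀ α : Fin s, Fin.castAdd s j ≠ Fin.natAdd r α := fun α h => by
    have := congrArg Fin.val h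
    simp at this
    omega
  rw [map_sum]
  refine Finset.sum_eq_zero fun α _ => ?_
  rw [map_smul, h.orthonormal x hx, if_neg (hne α), smul_zero]

/-- The leafwise part of the metric, in terms of an adapted frame. -/
def leafForm (g : SmoothMetric (r + s) M)
    (e : Fin (r + s) → (x : M) → TangentSpace (𝓡 (r + s)) x) (x : M) :
    TangentSpace (𝓡 (r + s)) x →L[ℝ] TangentSpace (𝓡 (r + s)) x →L[ℝ] ℝ :=
  ∑ α : Fin s, dualSquare g x (e (Fin.natAdd r α) x)

lemma leafForm_apply (v w : TangentSpace (𝓡 (r + s)) x) :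
    leafForm g e x v w = ∑ α : Fin s,
      g.inner x (e (Fin.natAdd r α) x) v * g.inner x (e (Fin.natAdd r α) x) w := by
  simp only [leafForm, FunLike.coe_sum, Finset.sum_apply, dualSquare_apply]

lemma leafForm_symm (v w : TangentSpace (𝓡 (r + s)) x) :
    leafForm g e x v w = leafForm g e x w v := by
  simp only [leafForm_apply, mul_comm]

lemma IsAdaptedFrameOn.leafForm_of_mem (h : IsAdaptedFrameOn g F U e) (hx : x ∈ U)
    {v : TangentSpace (𝓡 (r + s)) x} (hv : v ∈ F.tangent x) (w : TangentSpace (𝓡 (r + s)) x) :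
    leafForm g e x v w = g.inner x v w := by
  rw [← h.span_eq x hx, Submodule.mem_span_range_iff_exists_fun] at hv
  obtain ⟨c, rfl⟩ := hv
  have hc : ∀ β : Fin s, g.inner x (e (Fin.natAdd r β) x)
      (∑ α, c α • e (Fin.natAdd r α) x) = c β := by
    intro β
    simp [map_sum, map_smul, h.orthonormal x hx]
  rw [leafForm_apply]
  simp only [hc, map_sum, map_smul, FunLike.coe_sum, Finset.sum_apply, FunLike.coe_smul,
    Pi.smul_apply, smul_eq_mul]

lemma IsAdaptedFrameOn.leafForm_of_isOrthogonalTo (h : IsAdaptedFrameOn g F U e) (hx : x ∈ U)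
    {v : TangentSpace (𝓡 (r + s)) x} (hv : IsOrthogonalTo g v (F.tangent x))
    (w : TangentSpace (𝓡 (r + s)) x) : leafForm g e x v w = 0 := by
  rw [leafForm_apply]
  refine Finset.sum_eq_zero fun α _ => ?_
  rw [g.symm, hv _ (h.mem_tangent hx α), zero_mul]

lemma IsAdaptedFrameOn.exists_add (h : IsAdaptedFrameOn g F U e) (hx : x ∈ U)
    (v : TangentSpace (𝓡 (r + s)) x) :
    ∃ p ∈ F.tangent x, ∃ q, IsOrthogonalTo g q (F.tangent x) ∧ v = p + q := by
  set p := ∑ α : Fin s, g.inner x (e (Fin.natAdd r α) x) v • e (Fin.natAdd r α) x with hp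
  refine ⟨p, Submodule.sum_mem _ fun α _ => Submodule.smul_mem _ _ (h.mem_tangent hx α), v - p,
    fun u hu => ?_, by abel⟩
  have h1 : g.inner x p u = leafForm g e x v u := by
    simp only [leafForm_apply, hp, map_sum, map_smul, FunLike.coe_sum, Finset.sum_apply,
      FunLike.coe_smul, Pi.smul_apply, smul_eq_mul]
  rw [map_sub, sub_apply, h1, leafForm_symm, h.leafForm_of_mem hx hu, g.symm, sub_self]

/-- On the leaf directions both forms are `g`, and on the orthogonal complement both vanish. Hence
the local forms glue to a global tensor `g_Y`. -/
lemma IsAdaptedFrameOn.leafForm_eq (h : IsAdaptedFrameOn g F U e) (h' : IsAdaptedFrameOn g F U' e')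
    (hx : x ∈ U) (hx' : x ∈ U') : leafForm g e x = leafForm g e' x := by
  ext v w
  obtain ⟨p, hp, q, hq, rfl⟩ := h.exists_add hx v
  rw [map_add, map_add, add_apply, add_apply, h.leafForm_of_mem hx hp, h'.leafForm_of_mem hx' hp,
    h.leafForm_of_isOrthogonalTo hx hq, h'.leafForm_of_isOrthogonalTo hx' hq]

lemma metric_self_nonneg (g : SmoothMetric (r + s) M) (v : TangentSpace (𝓡 (r + s)) x) :
    0 ≤ g.inner x v v := by
  rcases eq_or_ne v 0 with rfl | hv
  · simp
  · exact (g.pos x v hv).le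

lemma leafForm_self_nonneg (v : TangentSpace (𝓡 (r + s)) x) : 0 ≤ leafForm g e x v v := by
  rw [leafForm_apply]
  exact Finset.sum_nonneg fun α _ => mul_self_nonneg _

lemma IsAdaptedFrameOn.leafForm_self_le (h : IsAdaptedFrameOn g F U e) (hx : x ∈ U)
    (v : TangentSpace (𝓡 (r + s)) x) : leafForm g e x v v ≤ g.inner x v v := by
  obtain ⟨p, hp, q, hq, rfl⟩ := h.exists_add hx v
  have h1 : g.inner x q p = 0 := hq p hp
  have h2 := metric_self_nonneg g q
  simp only [map_add, add_apply, h.leafForm_of_mem hx hp, h.leafForm_of_isOrthogonalTo hx hq, h1,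
    g.symm x p q]
  linarith

lemma IsAdaptedFrameOn.contMDiffAt_leafForm (h : IsAdaptedFrameOn g F U e) (hx : x ∈ U) :
    ContMDiffAt (𝓡 (r + s)) ((𝓡 (r + s)).prod 𝓘(ℝ, EuclideanSpace ℝ (Fin (r + s)) →L[ℝ]
        EuclideanSpace ℝ (Fin (r + s)) →L[ℝ] ℝ)) ∞
      (fun x => TotalSpace.mk' (EuclideanSpace ℝ (Fin (r + s)) →L[ℝ]
          EuclideanSpace ℝ (Fin (r + s)) →L[ℝ] ℝ)
        (E := fun x : M => TangentSpace (𝓡 (r + s)) x →L[ℝ] TangentSpace (𝓡 (r + s)) x →L[ℝ] ℝ)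
        x (leafForm g e x)) x := by
  unfold leafForm
  exact ContMDiffAt.sum_section fun α _ => contMDiffAt_dualSquare g
    ((h.contMDiffOn (Fin.natAdd r α)).contMDiffAt (h.isOpen.mem_nhds hx))

/-- The unit ball of `B` lies in the unit ball of `g` scaled by `1/√κ`. -/
lemma isVonNBounded_of_mul_le {κ : ℝ} (hκ : 0 < κ) {B : TangentSpace (𝓡 (r + s)) x →L[ℝ]
      TangentSpace (𝓡 (r + s)) x →L[ℝ] ℝ} (hB : ∀ v, κ * g.inner x v v ≤ B v v) :
    Bornology.IsVonNBounded ℝ {v | B v v < 1} := by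
  have h := (g.isVonNBounded x).image
    ((√κ)⁻¹ • ContinuousLinearMap.id ℝ (TangentSpace (𝓡 (r + s)) x))
  refine Bornology.IsVonNBounded.subset ?_ h
  intro v hv
  refine ⟨√κ • v, ?_, ?_⟩
  · simp only [Set.mem_ofPred_eq, map_smul, FunLike.coe_smul, Pi.smul_apply, smul_eq_mul]
    rw [← mul_assoc, Real.mul_self_sqrt hκ.le]
    exact (hB v).trans_lt hv
  · simp [smul_smul, mul_inv_cancel₀ (Real.sqrt_pos.2 hκ).ne']

set_option synthInstance.maxHeartbeats 200000 in
/-- The metric `g + κ g_Y`. -/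
def leafScaledMetric (hg : IsBundleLike g F) (κ : ℝ) (hκ : -1 < κ) : SmoothMetric (r + s) M := by
  choose U e hx h _ using hg
  -- From `0 ≤ g_Y ≤ g`: for `κ ≥ 0` drop the `g_Y` term, for `κ ≤ 0` replace `g_Y` by `g`.
  have hlow : ∀ x v, min 1 (1 + κ) * g.inner x v v
      ≤ (g.inner x + κ • leafForm g (e x) x) v v := by
    intro x v
    have h1 := metric_self_nonneg g v
    have h2 : 0 ≤ leafForm g (e x) x v v := leafForm_self_nonneg v
    have h3 := (h x).leafForm_self_le (hx x) v
    simp only [add_apply, FunLike.coe_smul, Pi.smul_apply, smul_eq_mul]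
    rcases le_total 0 κ with hk | hk
    · have := mul_le_mul_of_nonneg_right (min_le_left 1 (1 + κ)) h1
      nlinarith
    · have := mul_le_mul_of_nonneg_right (min_le_right 1 (1 + κ)) h1
      nlinarith
  have hmin : 0 < min 1 (1 + κ) := lt_min one_pos (by linarith)
  exact
  { inner := fun x => g.inner x + κ • leafForm g (e x) x
    symm := fun x v w => by
      simp only [add_apply, FunLike.coe_smul, Pi.smul_apply, g.symm x v w,
        leafForm_symm (e := e x) v w]
    pos := fun x v hv => (mul_pos hmin (g.pos x v hv)).trans_le (hlow x v)
    isVonNBounded := fun x => isVonNBounded_of_mul_le hmin (hlow x)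
    contMDiff := by
      intro x
      have h1 := (g.contMDiff.contMDiffAt (x := x)).add_section
        (((h x).contMDiffAt_leafForm (hx x)).const_smul_section (a := κ))
      -- The frame chosen at `z` need not depend continuously on `z`, but the leafwise form does not
      -- depend on the frame. Near `x` the frame chosen at `x` can be used throughout.
      refine h1.congr_of_eventuallyEq ?_
      filter_upwards [(h x).isOpen.mem_nhds (hx x)] with z hz
      simp only [Pi.add_apply, Pi.smul_apply, (h z).leafForm_eq (h x) (hx z) hz] }

lemma isCollapse_leafScaledMetric (hg : IsBundleLike g F) {f : ℝ} (hκ : -1 < 1 / f ^ 2 - 1) :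
    IsCollapse g F f (leafScaledMetric hg (1 / f ^ 2 - 1) hκ) := by
  intro x v w
  -- Recovers the frame selected by choice inside `leafScaledMetric`, so that its inner product
  -- unfolds definitionally.
  have key : ∃ (U : Set M) (e : Fin (r + s) → (x : M) → TangentSpace (𝓡 (r + s)) x),
      x ∈ U ∧ IsAdaptedFrameOn g F U e ∧
      ∀ v w, (leafScaledMetric hg (1 / f ^ 2 - 1) hκ).inner x v w
        = g.inner x v w + (1 / f ^ 2 - 1) * leafForm g e x v w :=
    ⟨_, _, (hg x).choose_spec.choose_spec.1, (hg x).choose_spec.choose_spec.2.1,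
      fun v w => rfl⟩
  obtain ⟨U, e, hx, h, hi⟩ := key
  simp only [hi]
  refine ⟨fun hv _ => ?_, fun hv _ => ?_, fun hv hw => ?_⟩
  · rw [h.leafForm_of_mem hx hv]
    ring
  · rw [h.leafForm_of_isOrthogonalTo hx hv]
    ring
  · rw [h.leafForm_of_isOrthogonalTo hx hv, hv w hw]
    ring

end Collapse

/-! ### Curvature terms and their scaling -/

section FrameTerms

open Set Bundle VectorField

variable {n : ℕ} {M : Type*} [TopologicalSpace M]
  [ChartedSpace (EuclideanSpace ℝ (Fin n)) M]

lemma dirDeriv_congr {f h : M → ℝ} {x : M} (hfh : f =ᶠ[nhds x] h) (v : TangentSpace (𝓡 n) x) :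
    dirDeriv f x v = dirDeriv h x v := by
  rw [dirDeriv, dirDeriv, hfh.mfderiv_eq]
  rfl

lemma dirDeriv_const_mul {f : M → ℝ} {x : M} (hf : MDifferentiableAt (𝓡 n) 𝓘(ℝ, ℝ) f x) (c : ℝ)
    (v : TangentSpace (𝓡 n) x) :
    dirDeriv (fun z => c * f z) x (c • v) = c ^ 2 * dirDeriv f x v := by
  have h : mfderiv (𝓡 n) 𝓘(ℝ, ℝ) (fun z => c * f z) x = c • mfderiv (𝓡 n) 𝓘(ℝ, ℝ) f x :=
    const_smul_mfderiv hf c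
  have h1 : dirDeriv (fun z => c * f z) x (c • v) = c * dirDeriv f x (c • v) :=
    congrArg (fun A : EuclideanSpace ℝ (Fin n) →L[ℝ] ℝ => A (c • v)) h
  have h2 : dirDeriv f x (c • v) = c * dirDeriv f x v :=
    (mfderiv (𝓡 n) 𝓘(ℝ, ℝ) f x).map_smul c v
  rw [h1, h2, sq, mul_assoc]

variable [IsManifold (𝓡 n) ∞ M]

/-- The trace `∑_b c_{abb}` of the structure coefficients. -/
def structTrace (g : SmoothMetric n M) {κ : Type*} [Fintype κ]
    (e : κ → (x : M) → TangentSpace (𝓡 n) x) (a : κ) (x : M) : ℝ :=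
  ∑ b, structCoeff g e a b b x

/-- The part of the scalar curvature which is quadratic in the frame vector `eₐ`. -/
def frameTerm (g : SmoothMetric n M) {κ : Type*} [Fintype κ]
    (e : κ → (x : M) → TangentSpace (𝓡 n) x) (a : κ) (x : M) : ℝ :=
  2 * dirDeriv (structTrace g e a) x (e a x) - structTrace g e a x ^ 2
    - (1 / 2) * ∑ b, ∑ d, structCoeff g e a b d x * structCoeff g e a d b x

/-- Separates terms by scaling behaviour: under rescaling of frame and metric each `frameTerm` picks
up the square of its own weight, and only the pure squares of structure coefficients scale in a
mixed way. -/
lemma frameScalar_eq (g : SmoothMetric n M) {κ : Type*} [Fintype κ]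
    (e : κ → (x : M) → TangentSpace (𝓡 n) x) (x : M) :
    frameScalar g e x = ∑ a, frameTerm g e a x
      - (1 / 4) * ∑ a, ∑ b, ∑ d, structCoeff g e a b d x ^ 2 := by
  have h : ∀ a, frameTerm g e a x
      = 2 * dirDeriv (fun z => ∑ b, structCoeff g e a b b z) x (e a x)
        - (∑ b, structCoeff g e a b b x) ^ 2
        - (1 / 2) * ∑ b, ∑ d, structCoeff g e a b d x * structCoeff g e a d b x := fun a => rfl
  simp_rw [h, frameScalar, structQuadratic]
  rw [Finset.sum_sub_distrib (g := fun a =>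
    (1 / 2) * ∑ b, ∑ d, structCoeff g e a b d x * structCoeff g e a d b x), ← Finset.mul_sum]
  ring

variable {g : SmoothMetric n M} {κ : Type*} [Fintype κ]
  {e : κ → (x : M) → TangentSpace (𝓡 n) x} {U : Set M}

lemma contMDiffOn_structTrace (hU : IsOpen U)
    (he : ∀ i, ContMDiffOn (𝓡 n) (𝓡 n).tangent ∞
      (fun x => (⟨x, e i x⟩ : TangentBundle (𝓡 n) M)) U) (a : κ) :
    ContMDiffOn (𝓡 n) 𝓘(ℝ, ℝ) ∞ (structTrace g e a) U :=
  contMDiffOn_finsetSum fun b _ => contMDiffOn_structCoeff g hU he a b b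

lemma continuousOn_dirDeriv (hU : IsOpen U) {f : M → ℝ} (hf : ContMDiffOn (𝓡 n) 𝓘(ℝ, ℝ) ∞ f U)
    {X : (x : M) → TangentSpace (𝓡 n) x}
    (hX : ContMDiffOn (𝓡 n) (𝓡 n).tangent ∞
      (fun x => (⟨x, X x⟩ : TangentBundle (𝓡 n) M)) U) :
    ContinuousOn (fun x => dirDeriv f x (X x)) U := by
  have i1 : IsManifold (𝓡 n) 1 M := IsManifold.of_le (n := ∞) (by norm_cast)
  have h1 : ContMDiffOn (𝓡 n).tangent (𝓘(ℝ, ℝ)).tangent ∞ (tangentMapWithin (𝓡 n) 𝓘(ℝ, ℝ) f U)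
      (Bundle.TotalSpace.proj ⁻¹' U) :=
    hf.contMDiffOn_tangentMapWithin (by simp) hU.uniqueMDiffOn
  have h2 := h1.comp hX fun y hy => hy
  have h3 := (contMDiff_snd_tangentBundle_modelSpace (n := ∞) ℝ 𝓘(ℝ, ℝ)).comp_contMDiffOn h2
  refine h3.continuousOn.congr fun x hx => ?_
  change mfderiv (𝓡 n) 𝓘(ℝ, ℝ) f x (X x) = mfderivWithin (𝓡 n) 𝓘(ℝ, ℝ) f U x (X x)
  rw [mfderivWithin_of_isOpen hU hx]

lemma continuousOn_frameTerm (hU : IsOpen U)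
    (he : ∀ i, ContMDiffOn (𝓡 n) (𝓡 n).tangent ∞
      (fun x => (⟨x, e i x⟩ : TangentBundle (𝓡 n) M)) U) (a : κ) :
    ContinuousOn (frameTerm g e a) U := by
  have hc : ∀ a b d, ContinuousOn (structCoeff g e a b d) U := fun a b d =>
    (contMDiffOn_structCoeff g hU he a b d).continuousOn
  have ht := contMDiffOn_structTrace (g := g) hU he a
  exact ((continuousOn_const.mul (continuousOn_dirDeriv hU ht (he a))).sub
    (ht.continuousOn.pow 2)).sub (continuousOn_const.mul (continuousOn_finsetSum _ fun b _ =>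
      continuousOn_finsetSum _ fun d _ => (hc a b d).mul (hc a d b)))

lemma continuousOn_sum_structCoeff_sq (hU : IsOpen U)
    (he : ∀ i, ContMDiffOn (𝓡 n) (𝓡 n).tangent ∞
      (fun x => (⟨x, e i x⟩ : TangentBundle (𝓡 n) M)) U) :
    ContinuousOn (fun x => ∑ a, ∑ b, ∑ d, structCoeff g e a b d x ^ 2) U :=
  continuousOn_finsetSum _ fun a _ => continuousOn_finsetSum _ fun b _ =>
    continuousOn_finsetSum _ fun d _ =>
      (contMDiffOn_structCoeff g hU he a b d).continuousOn.pow 2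

/-- The effect on the curvature terms of multiplying the frame vectors by constants `w`, and the
metric on each of them by `w⁻²`. -/
lemma frameTerm_smul {g' : SmoothMetric n M} (hU : IsOpen U)
    (he : ∀ i, ContMDiffOn (𝓡 n) (𝓡 n).tangent ∞
      (fun x => (⟨x, e i x⟩ : TangentBundle (𝓡 n) M)) U) {w : κ → ℝ} (hw : ∀ i, w i ≠ 0)
    (hc : ∀ x ∈ U, ∀ a b d, structCoeff g' (fun i => w i • e i) a b d x
      = w a * w b / w d * structCoeff g e a b d x) {x : M} (hx : x ∈ U) (a : κ) :
    frameTerm g' (fun i => w i • e i) a x = w a ^ 2 * frameTerm g e a x := by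
  have ht : ∀ z ∈ U, structTrace g' (fun i => w i • e i) a z = w a * structTrace g e a z := by
    intro z hz
    rw [structTrace, structTrace, Finset.mul_sum]
    refine Finset.sum_congr rfl fun b _ => ?_
    rw [hc z hz, mul_div_assoc, div_self (hw b), mul_one]
  have hd : dirDeriv (structTrace g' (fun i => w i • e i) a) x ((w a • e a) x)
      = w a ^ 2 * dirDeriv (structTrace g e a) x (e a x) := by
    rw [dirDeriv_congr (h := fun z => w a * structTrace g e a z)
      (by filter_upwards [hU.mem_nhds hx] with z hz using ht z hz)]
    exact dirDeriv_const_mul (((contMDiffOn_structTrace hU he a).contMDiffAt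
      (hU.mem_nhds hx)).mdifferentiableAt (by simp)) _ _
  -- The ratios `w b / w d` and `w d / w b` cancel, leaving only `w a ^ 2`.
  have hs : ∀ b d, structCoeff g' (fun i => w i • e i) a b d x
      * structCoeff g' (fun i => w i • e i) a d b x
      = w a ^ 2 * (structCoeff g e a b d x * structCoeff g e a d b x) := by
    intro b d
    rw [hc x hx, hc x hx]
    field_simp [hw b, hw d]
  simp only [frameTerm]
  simp_rw [hs, ← Finset.mul_sum]
  rw [hd, ht x hx]
  ring

end FrameTerms

/-! ### Lower bound for the scalar curvature of the collapsed metrics -/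

section Estimate

open Set Bundle VectorField

variable {r s : ℕ} {M : Type*} [TopologicalSpace M]
  [ChartedSpace (EuclideanSpace ℝ (Fin (r + s))) M]

/-- The factors by which the members of an adapted frame are multiplied to become orthonormal for
the collapsed metric. -/
def frameWeight (r s : ℕ) (f : ℝ) (i : Fin (r + s)) : ℝ :=
  Fin.addCases (fun _ => 1) (fun _ => f) i

@[simp] lemma frameWeight_castAdd (f : ℝ) (j : Fin r) :
    frameWeight r s f (Fin.castAdd s j) = 1 := by
  simp [frameWeight]

@[simp] lemma frameWeight_natAdd (f : ℝ) (α : Fin s) :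
    frameWeight r s f (Fin.natAdd r α) = f := by
  simp [frameWeight]

lemma frameWeight_pos {f : ℝ} (hf : 0 < f) (i : Fin (r + s)) : 0 < frameWeight r s f i := by
  refine Fin.addCases (fun j => ?_) (fun α => ?_) i
  · simp
  · simpa using hf

variable [IsManifold (𝓡 (r + s)) ∞ M]
  {g g' : SmoothMetric (r + s) M} {F : Foliation r s M} {U : Set M}
  {e : Fin (r + s) → (x : M) → TangentSpace (𝓡 (r + s)) x} {x : M} {f : ℝ}

lemma IsCollapse.inner_frame (hc : IsCollapse g F f g') (h : IsAdaptedFrameOn g F U e)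
    (hx : x ∈ U) (v : TangentSpace (𝓡 (r + s)) x) (i : Fin (r + s)) :
    g'.inner x v (e i x) = g.inner x v (e i x) / frameWeight r s f i ^ 2 := by
  obtain ⟨p, hp, q, hq, rfl⟩ := h.exists_add hx v
  refine Fin.addCases (fun j => ?_) (fun α => ?_) i
  · have ho := h.isOrthogonalTo hx j
    have h1 : g'.inner x p (e (Fin.castAdd s j) x) = 0 := by
      rw [g'.symm]
      exact (hc x _ _).2.2 ho hp
    have h2 : g.inner x p (e (Fin.castAdd s j) x) = 0 := by
      rw [g.symm]
      exact ho p hp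
    simp [map_add, h1, h2, (hc x q _).2.1 hq ho]
  · have hm := h.mem_tangent hx α
    simp only [map_add, add_apply, (hc x q _).2.2 hq hm, (hc x p _).1 hp hm, hq _ hm,
      frameWeight_natAdd]
    ring

lemma IsCollapse.orthonormal (hf : 0 < f) (hc : IsCollapse g F f g')
    (h : IsAdaptedFrameOn g F U e) (hx : x ∈ U) (i j : Fin (r + s)) :
    g'.inner x ((frameWeight r s f i • e i) x) ((frameWeight r s f j • e j) x)
      = if i = j then 1 else 0 := by
  have hw := (frameWeight_pos hf j).ne'
  simp only [Pi.smul_apply, map_smul, FunLike.coe_smul, smul_eq_mul, hc.inner_frame h hx,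
    h.orthonormal x hx]
  split_ifs with hij
  · subst hij
    field_simp
  · simp

lemma IsAdaptedFrameOn.contMDiffOn_smul (h : IsAdaptedFrameOn g F U e) (w : Fin (r + s) → ℝ)
    (i : Fin (r + s)) : ContMDiffOn (𝓡 (r + s)) (𝓡 (r + s)).tangent ∞
      (fun x => (⟨x, (w i • e i) x⟩ : TangentBundle (𝓡 (r + s)) M)) U :=
  ContMDiffOn.const_smul_section (h.contMDiffOn i)

lemma IsCollapse.structCoeff_smul (hf : 0 < f) (hc : IsCollapse g F f g')
    (h : IsAdaptedFrameOn g F U e) (hx : x ∈ U) (a b d : Fin (r + s)) :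
    structCoeff g' (fun i => frameWeight r s f i • e i) a b d x
      = frameWeight r s f a * frameWeight r s f b / frameWeight r s f d
        * structCoeff g e a b d x := by
  have hm : ∀ i, MDifferentiableAt (𝓡 (r + s)) (𝓡 (r + s)).tangent
      (fun x => (⟨x, e i x⟩ : TangentBundle (𝓡 (r + s)) M)) x := fun i =>
    ((h.contMDiffOn i).contMDiffAt (h.isOpen.mem_nhds hx)).mdifferentiableAt (by simp)
  have hm' : MDifferentiableAt (𝓡 (r + s)) (𝓡 (r + s)).tangent (fun x =>
      (⟨x, (frameWeight r s f b • e b) x⟩ : TangentBundle (𝓡 (r + s)) M)) x :=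
    ((h.contMDiffOn_smul (frameWeight r s f) b).contMDiffAt
      (h.isOpen.mem_nhds hx)).mdifferentiableAt (by simp)
  have i2 : IsManifold (𝓡 (r + s)) 2 M := IsManifold.of_le (n := ∞) (by norm_cast)
  have hw := (frameWeight_pos hf d).ne'
  rw [structCoeff, structCoeff, mlieBracket_const_smul_left (hm a),
    mlieBracket_const_smul_right (hm b)]
  simp only [Pi.smul_apply, map_smul, FunLike.coe_smul, smul_eq_mul, hc.inner_frame h hx]
  field_simp

/-- The scalar curvature in terms of an orthonormal frame. -/
lemma scalarCurvature_eq_frameScalar {n : ℕ} {N : Type*} [TopologicalSpace N]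
    [ChartedSpace (EuclideanSpace ℝ (Fin n)) N] [IsManifold (𝓡 n) ∞ N] {g : SmoothMetric n N}
    {U : Set N} {e : Fin n → (x : N) → TangentSpace (𝓡 n) x} {x : N} (hU : IsOpen U)
    (he : ∀ i, ContMDiffOn (𝓡 n) (𝓡 n).tangent ∞
      (fun x => (⟨x, e i x⟩ : TangentBundle (𝓡 n) N)) U)
    (horth : ∀ x ∈ U, ∀ i j, g.inner x (e i x) (e j x) = if i = j then 1 else 0) (hx : x ∈ U) :
    scalarCurvature g x = frameScalar g e x := by
  have i1 : IsManifold (𝓡 n) 1 N := IsManifold.of_le (n := ∞) (by norm_cast)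
  set φ := extChartAt (𝓡 n) x with hφ
  have hV : IsOpen (φ.target ∩ φ.symm ⁻¹' U) :=
    (continuousOn_extChartAt_symm x).isOpen_inter_preimage (isOpen_extChartAt_target x) hU
  have hmem : φ x ∈ φ.target ∩ φ.symm ⁻¹' U := by
    refine ⟨mem_extChartAt_target x, ?_⟩
    rw [mem_preimage, hφ, extChartAt_to_inv]
    exact hx
  have hι : ContMDiffOn (𝓡 n) (𝓡 n) ∞ φ.symm (φ.target ∩ φ.symm ⁻¹' U) :=
    (contMDiffOn_extChartAt_symm x).mono inter_subset_left
  have hrange : ∀ y ∈ φ.target ∩ φ.symm ⁻¹' U, ∀ a,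
      e a (φ.symm y) ∈ LinearMap.range (mfderiv (𝓡 n) (𝓡 n) φ.symm y).toLinearMap := by
    intro y hy a
    have hinv := isInvertible_mfderivWithin_extChartAt_symm (I := 𝓡 n) hy.1
    rw [ModelWithCorners.range_eq_univ, mfderivWithin_univ] at hinv
    obtain ⟨A, hA⟩ := hinv
    refine ⟨A.symm (e a (φ.symm y)), ?_⟩
    rw [← hA]
    exact A.apply_symm_apply _
  have key := coordScalar_pullbackGram hU hV hι he (fun y hy => hy.2) horth hrange hmem
  rw [hφ, extChartAt_to_inv] at key
  exact key

lemma IsCollapse.scalarCurvature_eq (hf : 0 < f) (hc : IsCollapse g F f g')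
    (h : IsAdaptedFrameOn g F U e) (hx : x ∈ U) :
    scalarCurvature g' x = ∑ a, frameWeight r s f a ^ 2 * frameTerm g e a x
      - (1 / 4) * ∑ a, ∑ b, ∑ d, (frameWeight r s f a * frameWeight r s f b
        / frameWeight r s f d * structCoeff g e a b d x) ^ 2 := by
  rw [scalarCurvature_eq_frameScalar h.isOpen (h.contMDiffOn_smul (frameWeight r s f))
    (fun z hz => hc.orthonormal hf h hz) hx, frameScalar_eq]
  congr 1
  · exact Finset.sum_congr rfl fun a _ => frameTerm_smul h.isOpen h.contMDiffOn
      (fun i => (frameWeight_pos hf i).ne') (fun z hz => hc.structCoeff_smul hf h hz) hx a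
  · simp_rw [hc.structCoeff_smul hf h hx]

/-- The leafwise members of an adapted frame. -/
def leafFrame (e : Fin (r + s) → (x : M) → TangentSpace (𝓡 (r + s)) x) :
    Fin s → (x : M) → TangentSpace (𝓡 (r + s)) x :=
  fun α => e (Fin.natAdd r α)

lemma IsAdaptedFrameOn.leafFrame_orthonormal (h : IsAdaptedFrameOn g F U e) :
    ∀ x ∈ U, ∀ α β, g.inner x (leafFrame e α x) (leafFrame e β x) = if α = β then 1 else 0 := by
  intro x hx α β
  simp [leafFrame, h.orthonormal x hx]

lemma IsAdaptedFrameOn.exists_leaf (h : IsAdaptedFrameOn g F U e) (hx : x ∈ U) :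
    ∃ (V : Set (EuclideanSpace ℝ (Fin s))) (ι : EuclideanSpace ℝ (Fin s) → M),
      IsLeafParametrization F V ι ∧ 0 ∈ V ∧ ι 0 = x ∧ MapsTo ι V U ∧ ∀ y ∈ V, ∀ α,
        leafFrame e α (ι y) ∈ LinearMap.range (mfderiv (𝓡 s) (𝓡 (r + s)) ι y).toLinearMap := by
  obtain ⟨V, ι, hι, h0, hx0⟩ := exists_isLeafParametrization F x
  refine ⟨V ∩ ι ⁻¹' U, ι, ⟨hι.contMDiffOn.continuousOn.isOpen_inter_preimage hι.isOpen h.isOpen,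
    hι.contMDiffOn.mono inter_subset_left, fun y hy => hι.range_mfderiv y hy.1⟩,
    ⟨h0, by rwa [mem_preimage, hx0]⟩, hx0, fun y hy => hy.2, fun y hy α => ?_⟩
  rw [hι.range_mfderiv y hy.1]
  exact h.mem_tangent hy.2 α

/-- By `coordScalar_pullbackGram` applied to a leaf parametrization, the frame expression is the
scalar curvature of the leaf through `x`. -/
lemma IsAdaptedFrameOn.frameScalar_leafFrame_pos (hF : HasPSCLeaves g F)
    (h : IsAdaptedFrameOn g F U e) (hx : x ∈ U) : 0 < frameScalar g (leafFrame e) x := by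
  obtain ⟨V, ι, hι, h0, rfl, hmaps, hrange⟩ := h.exists_leaf hx
  rw [← coordScalar_pullbackGram (e := leafFrame e) h.isOpen hι.isOpen hι.contMDiffOn
    (fun α => h.contMDiffOn (Fin.natAdd r α)) hmaps h.leafFrame_orthonormal hrange h0]
  exact hF V ι hι 0 h0

/-- The tangent bundle of a foliation is involutive. -/
lemma IsAdaptedFrameOn.mlieBracket_mem (h : IsAdaptedFrameOn g F U e) (hx : x ∈ U)
    (α β : Fin s) : mlieBracket (𝓡 (r + s)) (e (Fin.natAdd r α)) (e (Fin.natAdd r β)) x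
      ∈ F.tangent x := by
  obtain ⟨V, ι, hι, h0, rfl, hmaps, hrange⟩ := h.exists_leaf hx
  rw [← hι.range_mfderiv 0 h0]
  -- The bracket is the image of the bracket of the related fields on the leaf parametrization,
  -- hence lies in the range of its differential.
  exact ⟨_, mfderiv_lieBracket_pullFrame h.isOpen hι.isOpen hι.contMDiffOn
    (fun α => h.contMDiffOn (Fin.natAdd r α)) hmaps h.leafFrame_orthonormal hrange h0 α β⟩

lemma IsAdaptedFrameOn.structCoeff_eq_zero (h : IsAdaptedFrameOn g F U e) (hx : x ∈ U)
    {a b : Fin (r + s)} (hab : mlieBracket (𝓡 (r + s)) (e a) (e b) x ∈ F.tangent x) (j : Fin r) :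
    structCoeff g e a b (Fin.castAdd s j) x = 0 := by
  rw [structCoeff, g.symm]
  exact h.isOrthogonalTo hx j _ hab

lemma structCoeff_swap (a b d : Fin (r + s)) (x : M) :
    structCoeff g e a b d x = -structCoeff g e b a d x := by
  rw [structCoeff, structCoeff, mlieBracket_swap_apply, map_neg, neg_apply]

/-- Transverse indices contribute nothing. The bundle-like condition kills `c_αjk`, which settles
the trace and the products with two transverse indices; in a product `c_αjβ c_αβj` the second factor
vanishes by involutivity. -/
lemma IsAdaptedFrameOn.frameTerm_natAdd (h : IsAdaptedFrameOn g F U e)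
    (hbr : ∀ p ∈ U, ∀ (α : Fin s) (j : Fin r), mlieBracket (𝓡 (r + s)) (e (Fin.natAdd r α))
      (e (Fin.castAdd s j)) p ∈ F.tangent p) (hx : x ∈ U)
    (α : Fin s) : frameTerm g e (Fin.natAdd r α) x = frameTerm g (leafFrame e) α x := by
  have ht : ∀ z ∈ U, structTrace g e (Fin.natAdd r α) z = structTrace g (leafFrame e) α z := by
    intro z hz
    rw [structTrace, Fin.sum_univ_add, Finset.sum_eq_zero fun j _ =>
      h.structCoeff_eq_zero hz (hbr z hz α j) j, zero_add]
    rfl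
  rw [frameTerm, frameTerm, ht x hx, dirDeriv_congr (h := structTrace g (leafFrame e) α)
    (by filter_upwards [h.isOpen.mem_nhds hx] with z hz using ht z hz)]
  have h1 : ∀ j b, structCoeff g e (Fin.natAdd r α) (Fin.castAdd s j) b x
      * structCoeff g e (Fin.natAdd r α) b (Fin.castAdd s j) x = 0 := by
    intro j b
    refine Fin.addCases (fun k => ?_) (fun β => ?_) b
    · rw [h.structCoeff_eq_zero hx (hbr x hx α j) k, zero_mul]
    · rw [h.structCoeff_eq_zero hx (h.mlieBracket_mem hx α β) j, mul_zero]
  have h2 : ∑ b, ∑ d, structCoeff g e (Fin.natAdd r α) b d x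
      * structCoeff g e (Fin.natAdd r α) d b x = ∑ β, ∑ γ, structCoeff g (leafFrame e) α β γ x
        * structCoeff g (leafFrame e) α γ β x := by
    rw [Fin.sum_univ_add, Finset.sum_eq_zero fun j _ => Finset.sum_eq_zero fun b _ => h1 j b,
      zero_add]
    refine Finset.sum_congr rfl fun β _ => ?_
    rw [Fin.sum_univ_add, Finset.sum_eq_zero fun j _ => (mul_comm _ _).trans (h1 j _), zero_add]
    rfl
  rw [h2]
  rfl

/-- Only purely leafwise coefficients carry the weight `f`. The other nonvanishing ones have weight
`1` or, for leafwise components of transverse brackets, `1/f ≤ 1`; all coefficients with a larger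
weight vanish by the bundle-like condition or involutivity. -/
lemma IsAdaptedFrameOn.weighted_structCoeff_sq_le (h : IsAdaptedFrameOn g F U e)
    (hbr : ∀ p ∈ U, ∀ (α : Fin s) (j : Fin r), mlieBracket (𝓡 (r + s)) (e (Fin.natAdd r α))
      (e (Fin.castAdd s j)) p ∈ F.tangent p) (hx : x ∈ U)
    (hf : 1 ≤ f) :
    ∑ a, ∑ b, ∑ d, (frameWeight r s f a * frameWeight r s f b / frameWeight r s f d
        * structCoeff g e a b d x) ^ 2
      ≤ f ^ 2 * ∑ α, ∑ β, ∑ γ, structCoeff g (leafFrame e) α β γ x ^ 2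
        + ∑ a, ∑ b, ∑ d, structCoeff g e a b d x ^ 2 := by
  have hf0 : f ≠ 0 := by positivity
  have hf2 : 1 ≤ f ^ 2 := one_le_pow₀ hf
  -- Extension by zero of the leafwise squares to all index triples, so that the inequality can be
  -- checked termwise.
  set ψ : Fin (r + s) → Fin (r + s) → Fin (r + s) → ℝ := fun a b d =>
    Fin.addCases (fun _ => 0) (fun α => Fin.addCases (fun _ => 0) (fun β =>
      Fin.addCases (fun _ => 0) (fun γ => structCoeff g (leafFrame e) α β γ x ^ 2) d) b) a with hψ
  have hsum : ∑ α, ∑ β, ∑ γ, structCoeff g (leafFrame e) α β γ x ^ 2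
      = ∑ a, ∑ b, ∑ d, ψ a b d := by
    simp [hψ, Fin.sum_univ_add]
  rw [hsum, Finset.mul_sum, ← Finset.sum_add_distrib]
  refine Finset.sum_le_sum fun a _ => ?_
  rw [Finset.mul_sum, ← Finset.sum_add_distrib]
  refine Finset.sum_le_sum fun b _ => ?_
  rw [Finset.mul_sum, ← Finset.sum_add_distrib]
  refine Finset.sum_le_sum fun d _ => ?_
  have hmixed : ∀ (α : Fin s) (i k : Fin r),
      structCoeff g e (Fin.castAdd s i) (Fin.natAdd r α) (Fin.castAdd s k) x = 0 := by
    intro α i k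
    rw [structCoeff_swap, h.structCoeff_eq_zero hx (hbr x hx α i) k, neg_zero]
  refine Fin.addCases (fun i => ?_) (fun α => ?_) a <;>
  refine Fin.addCases (fun j => ?_) (fun β => ?_) b <;>
  refine Fin.addCases (fun k => ?_) (fun γ => ?_) d <;>
  simp only [hψ, Fin.addCases_left, Fin.addCases_right, frameWeight_castAdd, frameWeight_natAdd,
    mul_zero, zero_add, mul_one, one_mul, div_one, le_refl, div_self hf0, hmixed,
    h.structCoeff_eq_zero hx (hbr x hx _ _), h.structCoeff_eq_zero hx (h.mlieBracket_mem hx _ _)]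
  -- Of the eight index types only two survive: the leafwise component of a transverse bracket, and
  -- the purely leafwise coefficient.
  · rw [mul_pow, div_pow, one_pow]
    exact mul_le_of_le_one_left (sq_nonneg _) (div_le_one_of_le₀ hf2 (by positivity))
  · rw [mul_div_assoc, div_self hf0, mul_one, mul_pow]
    exact le_add_of_nonneg_right (sq_nonneg _)

/-- Lower bound for the scalar curvature of a collapsed metric. -/
lemma IsCollapse.le_scalarCurvature (hc : IsCollapse g F f g') (h : IsAdaptedFrameOn g F U e)
    (hbr : ∀ p ∈ U, ∀ (α : Fin s) (j : Fin r), mlieBracket (𝓡 (r + s)) (e (Fin.natAdd r α))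
      (e (Fin.castAdd s j)) p ∈ F.tangent p)
    (hx : x ∈ U) (hf : 1 ≤ f) :
    f ^ 2 * frameScalar g (leafFrame e) x + (∑ j, frameTerm g e (Fin.castAdd s j) x
      - (1 / 4) * ∑ a, ∑ b, ∑ d, structCoeff g e a b d x ^ 2) ≤ scalarCurvature g' x := by
  have hle := h.weighted_structCoeff_sq_le hbr hx hf
  rw [hc.scalarCurvature_eq (by positivity) h hx, frameScalar_eq,
    Fin.sum_univ_add fun a => frameWeight r s f a ^ 2 * frameTerm g e a x]
  have h1 : ∀ j, frameWeight r s f (Fin.castAdd s j) ^ 2 * frameTerm g e (Fin.castAdd s j) x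
      = frameTerm g e (Fin.castAdd s j) x := fun j => by
    rw [frameWeight_castAdd, one_pow, one_mul]
  have h2 : ∀ α, frameWeight r s f (Fin.natAdd r α) ^ 2 * frameTerm g e (Fin.natAdd r α) x
      = f ^ 2 * frameTerm g (leafFrame e) α x := fun α => by
    rw [frameWeight_natAdd, h.frameTerm_natAdd hbr hx]
  rw [Finset.sum_congr rfl fun j _ => h1 j, Finset.sum_congr rfl fun α _ => h2 α,
    ← Finset.mul_sum]
  linarith

end Estimate

/-! ### Local and compact positivity -/

section Positivity

open Set

variable {r s : ℕ} {M : Type*} [TopologicalSpace M]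
  [ChartedSpace (EuclideanSpace ℝ (Fin (r + s))) M] [IsManifold (𝓡 (r + s)) ∞ M]
  {g : SmoothMetric (r + s) M} {F : Foliation r s M}

/-- Near each point, all sufficiently collapsed metrics have positive scalar curvature. -/
lemma exists_nhds_scalarCurvature_pos (hg : IsBundleLike g F) (hF : HasPSCLeaves g F)
    {G : ℝ → SmoothMetric (r + s) M} (hG : ∀ f : ℝ, 0 < f → IsCollapse g F f (G f)) (x₀ : M) :
    ∃ t ∈ nhds x₀, ∃ f₀ : ℝ, 0 < f₀ ∧ ∀ f, f₀ ≤ f → ∀ x ∈ t, 0 < scalarCurvature (G f) x := by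
  obtain ⟨U, e, hx₀, h, hbr⟩ := hg x₀
  have hU := h.isOpen
  set S := frameScalar g (leafFrame e) with hS
  set C : M → ℝ := fun x => ∑ j, frameTerm g e (Fin.castAdd s j) x
    - (1 / 4) * ∑ a, ∑ b, ∑ d, structCoeff g e a b d x ^ 2 with hC
  have heL : ∀ α, ContMDiffOn (𝓡 (r + s)) (𝓡 (r + s)).tangent ∞
      (fun x => (⟨x, leafFrame e α x⟩ : TangentBundle (𝓡 (r + s)) M)) U :=
    fun α => h.contMDiffOn (Fin.natAdd r α)
  have hScont : ContinuousOn S U := by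
    refine ContinuousOn.congr (f := fun x => ∑ α, frameTerm g (leafFrame e) α x
      - (1 / 4) * ∑ α, ∑ β, ∑ γ, structCoeff g (leafFrame e) α β γ x ^ 2) ?_
      fun x _ => frameScalar_eq g (leafFrame e) x
    exact (continuousOn_finsetSum _ fun α _ => continuousOn_frameTerm hU heL α).sub
      (continuousOn_const.mul (continuousOn_sum_structCoeff_sq hU heL))
  have hCcont : ContinuousOn C U :=
    (continuousOn_finsetSum _ fun j _ => continuousOn_frameTerm hU h.contMDiffOn _).sub
      (continuousOn_const.mul (continuousOn_sum_structCoeff_sq hU h.contMDiffOn))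
  have hS₀ : 0 < S x₀ := h.frameScalar_leafFrame_pos hF hx₀
  have hSev : ∀ᶠ x in nhds x₀, S x₀ / 2 < S x :=
    (hScont.continuousAt (hU.mem_nhds hx₀)).eventually_const_lt (half_lt_self hS₀)
  have hCev : ∀ᶠ x in nhds x₀, C x₀ - 1 < C x :=
    (hCcont.continuousAt (hU.mem_nhds hx₀)).eventually_const_lt (sub_one_lt _)
  set K := |C x₀ - 1| with hK
  -- On this neighbourhood `S > S x₀ / 2` and `C > -K`. The summand `1` ensures `f ≥ 1`, as the
  -- estimate requires, and with the quotient it gives `f² S ≥ K + S x₀ / 2`.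
  refine ⟨_, (hSev.and hCev).and (hU.mem_nhds hx₀), K / (S x₀ / 2) + 1, by positivity, ?_⟩
  rintro f hf x ⟨⟨hx1, hx2⟩, hxU⟩
  have hK0 : 0 ≤ K / (S x₀ / 2) := by positivity
  have hf1 : 1 ≤ f := by linarith
  refine lt_of_lt_of_le ?_ ((hG f (by positivity)).le_scalarCurvature h hbr hxU hf1)
  have h1 : K + S x₀ / 2 ≤ f * (S x₀ / 2) := by
    have := mul_le_mul_of_nonneg_right hf (half_pos hS₀).le
    rwa [add_mul, one_mul, div_mul_cancel₀ _ (half_pos hS₀).ne'] at this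
  have h2 : f * (S x₀ / 2) ≤ f ^ 2 * (S x₀ / 2) :=
    mul_le_mul_of_nonneg_right (by nlinarith) (half_pos hS₀).le
  have h3 : f ^ 2 * (S x₀ / 2) ≤ f ^ 2 * S x := mul_le_mul_of_nonneg_left hx1.le (sq_nonneg f)
  have h4 : -K ≤ C x₀ - 1 := neg_abs_le _
  change 0 < f ^ 2 * S x + C x
  linarith

/-- Having a common threshold passes to subsets and, by taking maxima, to finite unions, and it
holds locally; compact induction does the rest. -/
lemma exists_scalarCurvature_pos_of_isCompact (hg : IsBundleLike g F) (hF : HasPSCLeaves g F)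
    {G : ℝ → SmoothMetric (r + s) M} (hG : ∀ f : ℝ, 0 < f → IsCollapse g F f (G f)) {K : Set M}
    (hK : IsCompact K) :
    ∃ f₀ : ℝ, 0 < f₀ ∧ ∀ f, f₀ ≤ f → ∀ x ∈ K, 0 < scalarCurvature (G f) x := by
  refine hK.induction_on ⟨1, one_pos, fun f _ x hx => absurd hx (notMem_empty x)⟩ ?_ ?_ ?_
  · rintro A B hAB ⟨f₀, h0, h⟩
    exact ⟨f₀, h0, fun f hf x hx => h f hf x (hAB hx)⟩
  · rintro A B ⟨f₁, h1, hA⟩ ⟨f₂, h2, hB⟩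
    refine ⟨max f₁ f₂, lt_max_of_lt_left h1, fun f hf x hx => ?_⟩
    rcases hx with hx | hx
    · exact hA f ((le_max_left _ _).trans hf) x hx
    · exact hB f ((le_max_right _ _).trans hf) x hx
  · intro x _
    obtain ⟨t, ht, h⟩ := exists_nhds_scalarCurvature_pos hg hF hG x
    exact ⟨t, mem_nhdsWithin_of_mem_nhds ht, h⟩

end Positivity

end FoliatedScalarCurvature

end

theorem corollary4p8 {r s : ℕ} {M : Type*} [TopologicalSpace M] [T2Space M]
    [SecondCountableTopology M] [ChartedSpace (EuclideanSpace ℝ (Fin (r + s))) M]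
    [IsManifold (𝓡 (r + s)) ∞ M]
    (F : FoliatedScalarCurvature.Foliation r s M)
    (g : FoliatedScalarCurvature.SmoothMetric (r + s) M)
    (hg : FoliatedScalarCurvature.IsBundleLike g F)
    (hF : FoliatedScalarCurvature.HasPSCLeaves g F) :
    (CompactSpace M → ∃ g' : FoliatedScalarCurvature.SmoothMetric (r + s) M,
      FoliatedScalarCurvature.IsPSC g') ∧
    ∃ G : ℝ → FoliatedScalarCurvature.SmoothMetric (r + s) M,
      (∀ f : ℝ, 0 < f → FoliatedScalarCurvature.IsCollapse g F f (G f)) ∧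
      (CompactSpace M → ∃ f₀ : ℝ, 0 < f₀ ∧ ∀ f : ℝ, f₀ ≤ f →
        FoliatedScalarCurvature.IsPSC (G f)) ∧
      (∀ K : Set M, IsCompact K → ∃ f₀ : ℝ, 0 < f₀ ∧ ∀ f : ℝ, f₀ ≤ f →
        ∀ x ∈ K, 0 < FoliatedScalarCurvature.scalarCurvature (G f) x) := by
  classical
  have hκ : ∀ f : ℝ, 0 < f → -1 < 1 / f ^ 2 - 1 := fun f hf => by
    have : 0 < 1 / f ^ 2 := by positivity
    linarith
  let G : ℝ → FoliatedScalarCurvature.SmoothMetric (r + s) M := fun f =>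
    if hf : 0 < f then FoliatedScalarCurvature.leafScaledMetric hg (1 / f ^ 2 - 1) (hκ f hf) else g
  have hG : ∀ f : ℝ, 0 < f → FoliatedScalarCurvature.IsCollapse g F f (G f) := by
    intro f hf
    simp only [G, dif_pos hf]
    exact FoliatedScalarCurvature.isCollapse_leafScaledMetric hg (hκ f hf)
  have hcpt := fun (K : Set M) (hK : IsCompact K) =>
    FoliatedScalarCurvature.exists_scalarCurvature_pos_of_isCompact hg hF hG hK
  have hpsc : CompactSpace M → ∃ f₀ : ℝ, 0 < f₀ ∧ ∀ f : ℝ, f₀ ≤ f →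
      FoliatedScalarCurvature.IsPSC (G f) := by
    intro _
    obtain ⟨f₀, h0, h⟩ := hcpt Set.univ isCompact_univ
    exact ⟨f₀, h0, fun f hf x => h f hf x (Set.mem_univ x)⟩
  refine ⟨fun hM => ?_, G, hG, hpsc, hcpt⟩
  obtain ⟨f₀, -, h⟩ := hpsc hM
  exact ⟨G f₀, h f₀ le_rfl⟩
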